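/- Let $G$ be a compact Lie group with normalised Haar measure $\mu$, acting continuously and transitively on a Hausdorff space $X$ with base point $x_0$ and stabiliser $H=G_{x_0}$ (so $X\cong G/H$). Let $\nu$ be the normalised Haar measure of $H$ and let $dx$ be the invariant measure $\int_X\phi\,dx=\int_G\tilde\phi\,d\mu$, where $\tilde\phi(g)=\phi(g\cdot x_0)$. Let $\widehat G$ be the set of equivalence classes of irreducible unitary representations $\pi:G\to U(d_\pi)$, and put $\hat f(\pi)=\int_G f(g)\pi(g)^*\,d\mu(g)$ for $f\in L^1(G)$; for functions $\phi$ on $X$ write $\hat\phi=\hat{\tilde\phi}$. Let $\widehat G_+\subset\widehat G$ be co-finite and let $p_t$ be a diffusive approximate identity with respect to $\widehat G_+$, that is, $p\in C^1((0,\infty);L^1(G))$, the operator norms $\|\hat p_t(\pi)\|$ are bounded uniformly in $\pi\in\widehat G$ and $t>0$, $\hat p_t(\pi)\to I$ as $t\to0$ for all $\pi\in\widehat G$, and for $\pi\in\widehat G_+$ moreover $\hat p_t(\pi)\to0$ as $t\to\infty$ and $-\partial_t\hat p_t(\pi)$ is positive semidefinite for all $t>0$. Let $L^2_0(G)=\bigoplus_{\pi\in\widehat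 G_+}\{g\mapsto\operatorname{tr}(\pi(g)A): A\in\mathbb C^{d_\pi\times d_\pi}\}$ (closed direct sum in $L^2(G)$) and $L^2_0(X)=\{\phi\in L^2(X):\tilde\phi\in L^2_0(G)\}$. Let $\alpha\ge0$ be a measurable weight on $\mathbb R_+=(0,\infty)$, and let $(\psi_\rho)_{\rho>0}\subset L^2(X)$, depending measurably on $\rho$, be a zonal diffusive wavelet family: each $\psi_\rho$ is $H$-invariant, and for every $t>0$ $$p_t^X\big|_{\widehat G_+}=\int_t^\infty\check\psi_\rho*\psi_\rho\;\alpha(\rho)\,d\rho,\qquad p_t^X(g\cdot x_0)=\int_H\int_H p_t(h_1gh_2)\,d\nu(h_1)\,d\nu(h_2).$$ Here $\check\psi_\rho(g\cdot x_0)=\overline{\psi_\rho(g^{-1}\cdot x_0)}$, $(\phi*\psi)(x)=\int_G\phi(g\cdot x_0)\psi(g^{-1}\cdot x)\,d\mu(g)$, and the identity is understood in the sense of Fourier series: for every irreducible $\pi$ the Fourier coefficients at $\pi$ of $\check\psi_\rho*\psi_\rho$ are integrable on $(t,\infty)$ with respect to $\alpha(\rho)\,d\rho$, and their integral is $\widehat{p_t^X}(\pi)$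 if $\pi\in\widehat G_+$ and $0$ otherwise. For $\phi\in L^2_0(X)$ and $\rho>0$, the function $(\phi\bullet\psi_\rho)(g)=\int_X\phi(x)\overline{\psi_\rho(g^{-1}\cdot x)}\,dx$ is constant on the cosets $gH$, hence defines a function $W_X\phi(\rho,\cdot)$ on $X$ by $W_X\phi(\rho,g\cdot x_0)=(\phi\bullet\psi_\rho)(g)$. The transform $\phi\mapsto W_X\phi$ is a linear isometry $$W_X:L^2_0(X)\to L^2(\mathbb R_+\times X,\ \alpha(\rho)\,d\rho\otimes dx),\qquad \langle W_X\phi_1,W_X\phi_2\rangle=\langle\phi_1,\phi_2\rangle,$$ i.e. it is unitary from $L^2_0(X)$ onto its (closed) range. -/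

import Mathlib

open MeasureTheory Set Filter Topology
open scoped ContDiff Manifold ComplexOrder

namespace DiffusiveWavelet

universe u v

/-- A (continuous, finite dimensional) irreducible unitary representation of `G` by unitary
matrices; irreducibility is expressed through the commutant. -/
structure IrrUnitaryRep (G : Type u) [Group G] [TopologicalSpace G] : Type u where
  /-- the dimension of the representation -/
  dim : ℕ
  dim_pos : 0 < dim
  /-- the underlying homomorphism into the unitary group -/
  toHom : G →* Matrix.unitaryGroup (Fin dim) ℂ
  continuous_toHom : Continuous toHom
  irreducible : ∀ A : Matrix (Fin dim) (Fin dim) ℂ,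
    (∀ g : G, (toHom g : Matrix (Fin dim) (Fin dim) ℂ) * A = A * (toHom g).1) →
      ∃ c : ℂ, A = c • (1 : Matrix (Fin dim) (Fin dim) ℂ)

section Group

variable {G : Type u} [Group G] [TopologicalSpace G]

/-- The matrix `π(g)`. -/
def IrrUnitaryRep.mat (π : IrrUnitaryRep G) (g : G) : Matrix (Fin π.dim) (Fin π.dim) ℂ :=
  (π.toHom g).1

/-- Equivalence of representations: there is an invertible intertwining matrix. -/
def IrrUnitaryRep.Equivalent (π σ : IrrUnitaryRep G) : Prop :=
  ∃ (A : Matrix (Fin π.dim) (Fin σ.dim) ℂ) (B : Matrix (Fin σ.dim) (Fin π.dim) ℂ),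
    A * B = 1 ∧ B * A = 1 ∧ ∀ g : G, π.mat g * A = A * σ.mat g

/-- Equivalence of irreducible unitary representations as a setoid. -/
def irrSetoid (G : Type u) [Group G] [TopologicalSpace G] : Setoid (IrrUnitaryRep G) where
  r := IrrUnitaryRep.Equivalent
  iseqv :=
    { refl := fun π => ⟨1, 1, by simp, by simp, by simp⟩
      symm := by
        rintro π σ ⟨A, B, hAB, hBA, h⟩
        refine ⟨B, A, hBA, hAB, fun g => ?_⟩
        calc σ.mat g * B = (B * A) * σ.mat g * B := by rw [hBA, Matrix.one_mul]
          _ = B * (A * σ.mat g) * B := by rw [Matrix.mul_assoc B A]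
          _ = B * (π.mat g * A) * B := by rw [h g]
          _ = B * π.mat g * (A * B) := by simp only [Matrix.mul_assoc]
          _ = B * π.mat g := by rw [hAB, Matrix.mul_one]
      trans := by
        rintro π σ τ ⟨A, B, hAB, hBA, h⟩ ⟨C, D, hCD, hDC, h'⟩
        refine ⟨A * C, D * B, ?_, ?_, fun g => ?_⟩
        · calc A * C * (D * B) = A * (C * D) * B := by simp only [Matrix.mul_assoc]
            _ = 1 := by rw [hCD, Matrix.mul_one, hAB]
        · calc D * B * (A * C) = D * (B * A) * C := by simp only [Matrix.mul_assoc]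
            _ = 1 := by rw [hBA, Matrix.mul_one, hDC]
        · calc π.mat g * (A * C) = (π.mat g * A) * C := by rw [Matrix.mul_assoc]
            _ = A * (σ.mat g * C) := by rw [h g, Matrix.mul_assoc]
            _ = A * C * τ.mat g := by rw [h' g, Matrix.mul_assoc] }

/-- The unitary dual: the set of equivalence classes of irreducible unitary representations. -/
def UnitaryDual (G : Type u) [Group G] [TopologicalSpace G] : Type u :=
  Quotient (irrSetoid G)

/-- The equivalence class of an irreducible representation. -/
def IrrUnitaryRep.cls (π : IrrUnitaryRep G) : UnitaryDual G :=
  Quotient.mk (irrSetoid G) π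

variable [MeasurableSpace G]

/-- The Fourier coefficient `∫ f(g) π(g)^* dμ(g)`, computed entrywise. -/
noncomputable def fourierCoeff (μ : Measure G) (f : G → ℂ) (π : IrrUnitaryRep G) :
    Matrix (Fin π.dim) (Fin π.dim) ℂ :=
  Matrix.of fun i j => ∫ g, f g * (π.mat g).conjTranspose i j ∂μ

/-- Diffusive approximate identity with respect to a co-finite set `S` of classes in the dual.
The norm in `bounded` is the operator norm for the Euclidean norm on `ℂ^d`. -/
structure IsDiffusiveApproxIdentity (μ : Measure G) (S : Set (UnitaryDual G))
    (p : ℝ → Lp ℂ 1 μ) : Prop where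
  cofinite : Sᶜ.Finite
  contDiff : ContDiffOn ℝ 1 p (Ioi 0)
  bounded : ∃ C : ℝ, ∀ π : IrrUnitaryRep G, ∀ t : ℝ, 0 < t →
    ‖Matrix.toEuclideanCLM (𝕜 := ℂ) (fourierCoeff μ (p t) π)‖ ≤ C
  tendsto_one : ∀ π : IrrUnitaryRep G,
    Tendsto (fun t : ℝ => fourierCoeff μ (p t) π) (𝓝[>] 0) (𝓝 1)
  tendsto_zero : ∀ π : IrrUnitaryRep G, π.cls ∈ S →
    Tendsto (fun t : ℝ => fourierCoeff μ (p t) π) atTop (𝓝 0)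
  posSemidef : ∀ π : IrrUnitaryRep G, π.cls ∈ S → ∀ t : ℝ, 0 < t →
    (-(Matrix.of fun i j => deriv (fun s : ℝ => fourierCoeff μ (p s) π i j) t)).PosSemidef

/-- The closed subspace `⊕_{π ∈ S} H_π` of `L²(G)`, where `H_π = {g ↦ tr (π(g) A)}`. -/
noncomputable def L2ZeroGroup (μ : Measure G) (S : Set (UnitaryDual G)) :
    Submodule ℂ (Lp ℂ 2 μ) :=
  (Submodule.span ℂ {f : Lp ℂ 2 μ | ∃ π : IrrUnitaryRep G, π.cls ∈ S ∧
    ∃ A : Matrix (Fin π.dim) (Fin π.dim) ℂ,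
      (f : G → ℂ) =ᵐ[μ] fun g => (π.mat g * A).trace}).topologicalClosure

/-- The involution `f ↦ conj (f (g⁻¹))` of functions on the group. -/
noncomputable def involution (f : G → ℂ) : G → ℂ := fun g => (starRingEnd ℂ) (f g⁻¹)

end Group

section HomogeneousSpace

variable {G : Type u} [Group G] [TopologicalSpace G] [MeasurableSpace G] [BorelSpace G]
variable {X : Type v} [TopologicalSpace X] [MeasurableSpace X] [BorelSpace X] [MulAction G X]

/-- The lift `g ↦ φ (g • x₀)` to `G` of a function on the homogeneous space. -/
def lift (x₀ : X) (φ : X → ℂ) : G → ℂ := fun g => φ (g • x₀)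

/-- The invariant measure `dx`, characterised by `∫ φ(x) dx = ∫ φ(g • x₀) dμ(g)`. -/
noncomputable def invMeasure (μ : Measure G) (x₀ : X) : Measure X :=
  μ.map fun g => g • x₀

theorem measurePreserving_orbit [ContinuousSMul G X] (μ : Measure G) (x₀ : X) :
    MeasurePreserving (fun g : G => g • x₀) μ (invMeasure μ x₀) :=
  ⟨(continuous_id.smul continuous_const).measurable, rfl⟩

/-- `L²_0(X)`: the functions in `L²(X)` whose lift belongs to `⊕_{π ∈ S} H_π`. -/
noncomputable def L2ZeroSpace [ContinuousSMul G X] (μ : Measure G) (x₀ : X)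
    (S : Set (UnitaryDual G)) : Submodule ℂ (Lp ℂ 2 (invMeasure μ x₀)) :=
  (L2ZeroGroup μ S).comap
    (Lp.compMeasurePreservingₗᵢ ℂ (fun g : G => g • x₀)
      (measurePreserving_orbit μ x₀)).toLinearMap

/-- A function (class) on `X` is zonal if it is invariant under the stabiliser of `x₀`. -/
def IsZonal (μ : Measure G) (x₀ : X) (φ : X → ℂ) : Prop :=
  ∀ h ∈ MulAction.stabilizer G x₀, (fun x => φ (h • x)) =ᵐ[invMeasure μ x₀] φ

/-- The group convolution `(φ * ψ)(x) = ∫ φ(g • x₀) ψ(g⁻¹ • x) dμ(g)` on `X`. It depends on its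
first factor only through the lift `a` of that factor, which is taken as the argument. -/
noncomputable def conv (μ : Measure G) (a : G → ℂ) (ψ : X → ℂ) : X → ℂ :=
  fun x => ∫ g, a g * ψ (g⁻¹ • x) ∂μ

/-- `ψˇ * ψ` for a zonal `ψ`, where `ψˇ` is the function on `X` whose lift is the involution of
the lift of `ψ`. -/
noncomputable def selfConv (μ : Measure G) (x₀ : X) (ψ : X → ℂ) : X → ℂ :=
  conv μ (involution (lift x₀ ψ)) ψ

/-- The lift to `G` of the zonal average `p^X` of a function `p` on `G`,
`p^X (g • x₀) = ∫_H ∫_H p (h₁ g h₂) dν(h₁) dν(h₂)`, with `H` the stabiliser of `x₀`. -/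
noncomputable def zonalAverageLift (x₀ : X) (ν : Measure (MulAction.stabilizer G x₀))
    (p : G → ℂ) : G → ℂ :=
  fun g => ∫ h₂, ∫ h₁, p ((h₁ : G) * g * (h₂ : G)) ∂ν ∂ν

/-- Zonal diffusive wavelet family. The admissibility condition
`p_t^X |_S = ∫_t^∞ (ψ_ρˇ * ψ_ρ) α(ρ) dρ` is an identity between (distributional) Fourier series
and is read weakly, i.e. tested against all matrix coefficients: the restriction to `S` keeps the
Fourier coefficients of `p_t^X` for classes in `S` and replaces the others by zero. -/
structure IsZonalWaveletFamily (μ : Measure G) (x₀ : X)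
    (ν : Measure (MulAction.stabilizer G x₀)) (S : Set (UnitaryDual G)) (p : ℝ → Lp ℂ 1 μ)
    (α : ℝ → ℝ) (ψ : ℝ → Lp ℂ 2 (invMeasure μ x₀)) : Prop where
  zonal : ∀ ρ : ℝ, 0 < ρ → IsZonal μ x₀ (ψ ρ)
  integrable : ∀ t : ℝ, 0 < t → ∀ (π : IrrUnitaryRep G) (i j : Fin π.dim),
    IntegrableOn (fun ρ : ℝ =>
      fourierCoeff μ (lift x₀ (selfConv μ x₀ (ψ ρ))) π i j * (α ρ : ℂ)) (Ioi t)
  admissible : ∀ t : ℝ, 0 < t → ∀ π : IrrUnitaryRep G, π.cls ∈ S → ∀ i j : Fin π.dim,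
    fourierCoeff μ (zonalAverageLift x₀ ν (p t)) π i j =
      ∫ ρ in Ioi t, fourierCoeff μ (lift x₀ (selfConv μ x₀ (ψ ρ))) π i j * (α ρ : ℂ)
  admissible_compl : ∀ t : ℝ, 0 < t → ∀ π : IrrUnitaryRep G, π.cls ∉ S → ∀ i j : Fin π.dim,
    0 = ∫ ρ in Ioi t, fourierCoeff μ (lift x₀ (selfConv μ x₀ (ψ ρ))) π i j * (α ρ : ℂ)

/-- The product `(φ • ψ)(g) = ∫ φ(x) conj (ψ(g⁻¹ • x)) dx`, a function on `G`. -/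
noncomputable def bullet (μ : Measure G) (x₀ : X) (φ ψ : X → ℂ) : G → ℂ :=
  fun g => ∫ x, φ x * (starRingEnd ℂ) (ψ (g⁻¹ • x)) ∂(invMeasure μ x₀)

/-- The wavelet transform `W φ (ρ, x) = (φ • ψ_ρ)(x)`: the value of `φ • ψ_ρ` at any `g` with
`g • x₀ = x` (for zonal `ψ_ρ` the choice does not matter). -/
noncomputable def waveletTransform [MulAction.IsPretransitive G X] (μ : Measure G) (x₀ : X)
    (ψ : ℝ → Lp ℂ 2 (invMeasure μ x₀)) (φ : X → ℂ) : ℝ × X → ℂ :=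
  fun z => bullet μ x₀ φ (ψ z.1) (Classical.choose (MulAction.exists_smul_eq G x₀ z.2))

end HomogeneousSpace

/-- The measure `α(ρ) dρ` on the half-line `(0, ∞)`. -/
noncomputable def scaleMeasure (α : ℝ → ℝ) : Measure ℝ :=
  (volume.restrict (Ioi 0)).withDensity fun ρ => ENNReal.ofReal (α ρ)

end DiffusiveWavelet

open DiffusiveWavelet

set_option linter.unusedSectionVars false

namespace DiffusiveWavelet

/-! ### Haar measure on a compact group -/

section CompactGroup

variable {G : Type*} [Group G] [TopologicalSpace G] [IsTopologicalGroup G]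
    [CompactSpace G] [T2Space G] [MeasurableSpace G] [BorelSpace G]

/-! Everything is lifted to `G`. With `w ρ` the lift of `ψ ρ` and `f` the lift of `φ`, the transform
becomes the correlation `g ↦ ⟨w ρ (g⁻¹ ·), f⟩`, and the orbit map preserves measure, so the isometry
can be proved for functions on `G` that are right invariant under `H`.

Let `f₁` be a matrix coefficient of `π`. The `L²(G)` pairing of the correlations of `f₁` and of an
arbitrary `f₂` depends on the window only through `ŵ(π) ŵ(π)*`
(`integral_corr_coeff_mul_conj_corr`), which is the Fourier coefficient of `ψˇ * ψ`
(`fourierCoeff_selfConv`). Integrated over `ρ > t`, admissibility turns it into `P p̂_t(π) P`, where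
`P = ∫_H π(h) dν(h)` (`fourierCoeff_biAverage`). As `t → 0` this tends to `P P`, so the pairings
tend to `⟨f₂, A f₁⟩`, with `A` the averaging of right translates over `H`. If `f₂` is right
`H`-invariant, this is `⟨f₂, f₁⟩`.

By linearity the limit formula holds on the algebraic span `K` of the coefficients in `S`. There `f₂
= f₁` gives a contraction estimate by monotone convergence, and Fatou extends it to the closure of
`K`. An invariant `f` in the closure is a limit of `u n ∈ K`, not necessarily invariant; but `⟨V f,
V (u n)⟩ = ⟨f, u n⟩` needs invariance on one side only, and passing to the limit gives `‖V f‖ =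
‖f‖`. This is why reproduction is tested against all `f₂`. Neither the Schur orthogonality relations
nor `P² = P` are needed. -/

instance (priority := 50) isMulRightInvariant_of_compactSpace (μ : Measure G) [μ.IsHaarMeasure]
    [IsProbabilityMeasure μ] : μ.IsMulRightInvariant := by
  refine ⟨fun g => ?_⟩
  have : IsProbabilityMeasure (μ.map (· * g)) := Measure.isProbabilityMeasure_map (by fun_prop)
  exact Measure.isHaarMeasure_eq_of_isProbabilityMeasure _ _

/-- On a compact group invariant measures are proportional to Haar measure, and comparing total
masses forces the factor to be 1. -/
instance (priority := 50) isInvInvariant_of_compactSpace (μ : Measure G) [μ.IsHaarMeasure]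
    [IsProbabilityMeasure μ] : μ.IsInvInvariant := by
  have h1 : IsProbabilityMeasure μ.inv := Measure.isProbabilityMeasure_map (by fun_prop)
  refine ⟨?_⟩
  have h := Measure.isMulInvariant_eq_smul_of_compactSpace μ.inv μ
  have h2 := congrArg (fun m : Measure G => m univ) h
  simp only [measure_univ, Measure.smul_apply] at h2
  rw [ENNReal.smul_def, smul_eq_mul, mul_one] at h2
  rw [h, ENNReal.coe_eq_one.mp h2.symm, one_smul]

/-- The shear `(x, y) ↦ (x, x y)` preserves `μ × μ`. This and the next lemma supply the hypothesis
of Fubini for convolutions and correlations. -/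
theorem integrable_prod_mul_shear [SecondCountableTopology G] {μ : Measure G} [μ.IsHaarMeasure]
    [IsProbabilityMeasure μ] {u v : G → ℂ} (hu : Integrable u μ) (hv : Integrable v μ) :
    Integrable (fun z : G × G => u z.1 * v (z.1 * z.2)) (μ.prod μ) :=
  (measurePreserving_prod_mul μ μ).integrable_comp_of_integrable (hu.mul_prod hv)

theorem integrable_prod_mul_inv_shear [SecondCountableTopology G] {μ : Measure G}
    [μ.IsHaarMeasure] [IsProbabilityMeasure μ] {u v : G → ℂ} (hu : Integrable u μ)
    (hv : Integrable v μ) :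
    Integrable (fun z : G × G => u z.1 * v (z.2⁻¹ * z.1)) (μ.prod μ) := by
  have h : MeasurePreserving (fun z : G × G => (z.1, z.2⁻¹ * z.1)) (μ.prod μ) (μ.prod μ) :=
    (MeasurePreserving.id μ).skew_product (g := fun a g => g⁻¹ * a)
      ((by fun_prop : Continuous fun z : G × G => z.2⁻¹ * z.1).measurable)
      (ae_of_all _ fun a =>
        ((measurePreserving_mul_right μ a).comp (Measure.measurePreserving_inv μ)).map_eq)
  exact h.integrable_comp_of_integrable (hu.mul_prod hv)

end CompactGroup

/-! ### Matrix coefficients -/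

namespace IrrUnitaryRep

variable {G : Type*} [Group G] [TopologicalSpace G] (π : IrrUnitaryRep G)

theorem mat_mul (g h : G) : π.mat (g * h) = π.mat g * π.mat h := by
  simp [mat]

theorem mat_mul_apply (g h : G) (i j : Fin π.dim) :
    π.mat (g * h) i j = ∑ l, π.mat g i l * π.mat h l j := by
  rw [mat_mul, Matrix.mul_apply]

theorem mat_inv (g : G) : π.mat g⁻¹ = (π.mat g).conjTranspose := by
  simp [mat, Matrix.star_eq_conjTranspose]

theorem mat_inv_apply (g : G) (i j : Fin π.dim) :
    π.mat g⁻¹ i j = (starRingEnd ℂ) (π.mat g j i) := by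
  rw [mat_inv]; rfl

theorem continuous_mat_apply (i j : Fin π.dim) : Continuous fun g => π.mat g i j :=
  (continuous_subtype_val.comp π.continuous_toHom).matrix_elem i j

theorem norm_mat_apply_le (g : G) (i j : Fin π.dim) : ‖π.mat g i j‖ ≤ 1 :=
  entry_norm_bound_of_unitary (π.toHom g).2 i j

end IrrUnitaryRep

/-! ### Correlations on the group and their Fourier coefficients -/

section Core

variable {G : Type*} [Group G] [TopologicalSpace G] [IsTopologicalGroup G]
    [CompactSpace G] [T2Space G] [SecondCountableTopology G] [MeasurableSpace G] [BorelSpace G]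
    (μ : Measure G) [μ.IsHaarMeasure] [IsProbabilityMeasure μ]

theorem fourierCoeff_apply (f : G → ℂ) (π : IrrUnitaryRep G) (i j : Fin π.dim) :
    fourierCoeff μ f π i j = ∫ g, f g * (starRingEnd ℂ) (π.mat g j i) ∂μ := rfl

/-- Left translation `f ↦ f (g⁻¹ ·)` on `L²(G)`. -/
noncomputable def leftTranslate (g : G) : Lp ℂ 2 μ →ₗᵢ[ℂ] Lp ℂ 2 μ :=
  Lp.compMeasurePreservingₗᵢ ℂ (fun k => g⁻¹ * k) (measurePreserving_mul_left μ g⁻¹)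

/-- Right translation `f ↦ f (· h)` on `L²(G)`. -/
noncomputable def rightTranslate (h : G) : Lp ℂ 2 μ →ₗᵢ[ℂ] Lp ℂ 2 μ :=
  Lp.compMeasurePreservingₗᵢ ℂ (fun k => k * h) (measurePreserving_mul_right μ h)

theorem coeFn_leftTranslate (g : G) (f : Lp ℂ 2 μ) :
    leftTranslate μ g f =ᵐ[μ] fun k => f (g⁻¹ * k) :=
  Lp.coeFn_compMeasurePreserving f (measurePreserving_mul_left μ g⁻¹)

theorem coeFn_rightTranslate (h : G) (f : Lp ℂ 2 μ) :
    rightTranslate μ h f =ᵐ[μ] fun k => f (k * h) :=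
  Lp.coeFn_compMeasurePreserving f (measurePreserving_mul_right μ h)

/-- Joint continuity makes correlations continuous in `g`, and jointly measurable in `(ρ, g)` when
the window depends measurably on `ρ`. -/
theorem continuous_leftTranslate :
    Continuous fun z : G × Lp ℂ 2 μ => leftTranslate μ z.1 z.2 := by
  let := TopologicalSpace.metrizableSpaceMetric G
  let F : C(G × Lp ℂ 2 μ, C(G, G)) :=
    (ContinuousMap.mk (fun a : (G × Lp ℂ 2 μ) × G => a.1.1⁻¹ * a.2) (by fun_prop)).curry
  exact continuous_snd.compMeasurePreservingLp F.continuous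
    (fun z => measurePreserving_mul_left μ z.1⁻¹) (by simp)

/-- The correlation `g ↦ ∫ f(k) conj (w (g⁻¹ k)) dμ(k)` of two elements of `L²(G)`. -/
noncomputable def corr (w f : Lp ℂ 2 μ) (g : G) : ℂ := inner ℂ (leftTranslate μ g w) f

theorem corr_eq_integral (w f : Lp ℂ 2 μ) (g : G) :
    corr μ w f g = ∫ k, f k * (starRingEnd ℂ) (w (g⁻¹ * k)) ∂μ := by
  rw [corr, L2.inner_def]
  refine integral_congr_ae ?_
  filter_upwards [coeFn_leftTranslate μ g w] with k hk
  rw [hk, RCLike.inner_apply]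

theorem continuous_corr (f : Lp ℂ 2 μ) :
    Continuous fun z : G × Lp ℂ 2 μ => corr μ z.2 f z.1 :=
  (continuous_leftTranslate μ).inner continuous_const

theorem continuous_corr_right (w f : Lp ℂ 2 μ) : Continuous fun g => corr μ w f g := by
  have h : Continuous fun g : G => (g, w) := by fun_prop
  have h2 := (continuous_corr μ f).comp h
  rw [Function.comp_def] at h2
  exact h2

theorem corr_add (w f₁ f₂ : Lp ℂ 2 μ) (g : G) :
    corr μ w (f₁ + f₂) g = corr μ w f₁ g + corr μ w f₂ g := inner_add_right _ _ _

theorem corr_smul (w f : Lp ℂ 2 μ) (c : ℂ) (g : G) :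
    corr μ w (c • f) g = c * corr μ w f g := inner_smul_right _ _ _

theorem continuous_corr_snd (w : Lp ℂ 2 μ) (g : G) : Continuous fun f => corr μ w f g :=
  continuous_const.inner continuous_id

theorem memLp_mat (π : IrrUnitaryRep G) (i j : Fin π.dim) :
    MemLp (fun g => π.mat g i j) 2 μ :=
  (π.continuous_mat_apply i j).memLp_of_hasCompactSupport (.of_compactSpace _)

/-- The matrix coefficient `g ↦ π(g)_{ij}` as an element of `L²(G)`. -/
noncomputable def coeff (π : IrrUnitaryRep G) (i j : Fin π.dim) : Lp ℂ 2 μ :=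
  (memLp_mat μ π i j).toLp _

theorem coeFn_coeff (π : IrrUnitaryRep G) (i j : Fin π.dim) :
    coeff μ π i j =ᵐ[μ] fun g => π.mat g i j := MemLp.coeFn_toLp _

theorem inner_coeff (f : Lp ℂ 2 μ) (π : IrrUnitaryRep G) (i j : Fin π.dim) :
    inner ℂ f (coeff μ π i j) = ∫ a, π.mat a i j * (starRingEnd ℂ) (f a) ∂μ := by
  rw [L2.inner_def]
  refine integral_congr_ae ?_
  filter_upwards [coeFn_coeff μ π i j] with k hk
  rw [hk, RCLike.inner_apply]

variable {μ} in
theorem integrable_mul_mat {f : G → ℂ} (hf : Integrable f μ) (π : IrrUnitaryRep G)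
    (i j : Fin π.dim) : Integrable (fun g => f g * π.mat g i j) μ :=
  hf.mul_bdd (c := 1) (π.continuous_mat_apply i j).aestronglyMeasurable
    (ae_of_all _ fun g => π.norm_mat_apply_le g i j)

variable {μ} in
theorem integrable_mul_conj_mat {f : G → ℂ} (hf : Integrable f μ) (π : IrrUnitaryRep G)
    (i j : Fin π.dim) : Integrable (fun g => f g * (starRingEnd ℂ) (π.mat g i j)) μ :=
  hf.mul_bdd (c := 1)
    (RCLike.continuous_conj.comp (π.continuous_mat_apply i j)).aestronglyMeasurable
    (ae_of_all _ fun g => by simpa using π.norm_mat_apply_le g i j)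

theorem integrable_coe (f : Lp ℂ 2 μ) : Integrable f μ := (Lp.memLp f).integrable (by norm_num)

theorem integrable_conj_coe (f : Lp ℂ 2 μ) : Integrable (fun g => (starRingEnd ℂ) (f g)) μ :=
  RCLike.conjCLE.toContinuousLinearMap.integrable_comp (integrable_coe μ f) |>.congr (by
    exact ae_of_all _ fun _ => by simp)

theorem conj_fourierCoeff_apply (f : G → ℂ) (π : IrrUnitaryRep G) (i j : Fin π.dim) :
    (starRingEnd ℂ) (fourierCoeff μ f π i j) = ∫ g, (starRingEnd ℂ) (f g) * π.mat g j i ∂μ := by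
  rw [fourierCoeff_apply, ← integral_conj]
  simp

/-- Substitute `k ↦ g k` and use `π(g k) = π(g) π(k)`: a correlation with a matrix coefficient is
again a combination of matrix coefficients. -/
theorem corr_coeff (w : Lp ℂ 2 μ) (π : IrrUnitaryRep G) (i j : Fin π.dim) (g : G) :
    corr μ w (coeff μ π i j) g =
      ∑ l, π.mat g i l * (starRingEnd ℂ) (fourierCoeff μ w π j l) := by
  rw [corr_eq_integral]
  calc ∫ k, coeff μ π i j k * (starRingEnd ℂ) (w (g⁻¹ * k)) ∂μ
      = ∫ k, π.mat k i j * (starRingEnd ℂ) (w (g⁻¹ * k)) ∂μ := by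
        refine integral_congr_ae ?_
        filter_upwards [coeFn_coeff μ π i j] with k hk
        rw [hk]
    _ = ∫ k, π.mat (g * k) i j * (starRingEnd ℂ) (w (g⁻¹ * (g * k))) ∂μ :=
        (integral_mul_left_eq_self (fun k => π.mat k i j * (starRingEnd ℂ) (w (g⁻¹ * k))) g).symm
    _ = ∫ k, ∑ l, π.mat g i l * ((starRingEnd ℂ) (w k) * π.mat k l j) ∂μ := by
        refine integral_congr_ae (ae_of_all _ fun k => ?_)
        simp only [inv_mul_cancel_left, π.mat_mul_apply, Finset.sum_mul]
        exact Finset.sum_congr rfl fun l _ => by ring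
    _ = ∑ l, π.mat g i l * (starRingEnd ℂ) (fourierCoeff μ w π j l) := by
        rw [integral_finsetSum _ fun l _ =>
          (integrable_mul_mat (integrable_conj_coe μ w) π l j).const_mul _]
        simp_rw [integral_const_mul, conj_fourierCoeff_apply]

theorem integral_mat_mul_conj_corr (w f : Lp ℂ 2 μ) (π : IrrUnitaryRep G) (i l : Fin π.dim) :
    ∫ g, π.mat g i l * (starRingEnd ℂ) (corr μ w f g) ∂μ =
      ∑ m, fourierCoeff μ w π m l * inner ℂ f (coeff μ π i m) := by
  have hint : Integrable (Function.uncurry fun a g : G =>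
      (starRingEnd ℂ) (f a) * (π.mat g i l * w (g⁻¹ * a))) (μ.prod μ) := by
    refine ((integrable_prod_mul_inv_shear (integrable_conj_coe μ f) (integrable_coe μ w)).mul_bdd
      (c := 1) (g := fun z => π.mat z.2 i l)
      ((π.continuous_mat_apply i l).comp continuous_snd).aestronglyMeasurable
      (ae_of_all _ fun g => π.norm_mat_apply_le g.2 i l)).congr (ae_of_all _ fun z => ?_)
    simp only [Function.uncurry]
    ring
  calc ∫ g, π.mat g i l * (starRingEnd ℂ) (corr μ w f g) ∂μ
      = ∫ g, ∫ a, (starRingEnd ℂ) (f a) * (π.mat g i l * w (g⁻¹ * a)) ∂μ ∂μ := by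
        refine integral_congr_ae (ae_of_all _ fun g => ?_)
        simp only [corr_eq_integral]
        rw [← integral_conj, ← integral_const_mul]
        refine integral_congr_ae (ae_of_all _ fun a => ?_)
        simp only [map_mul, Complex.conj_conj]
        ring
    _ = ∫ a, (starRingEnd ℂ) (f a) * ∫ g, π.mat g i l * w (g⁻¹ * a) ∂μ ∂μ := by
        rw [← integral_integral_swap hint]
        simp_rw [integral_const_mul]
    _ = ∫ a, ∑ m, fourierCoeff μ w π m l * (π.mat a i m * (starRingEnd ℂ) (f a)) ∂μ := by
        refine integral_congr_ae (ae_of_all _ fun a => ?_)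
        -- The substitution `g = a c⁻¹` makes `π(g) = π(a) π(c)*`, which separates `a` from the
        -- Fourier coefficient of `w`.
        have h1 : ∫ g, π.mat g i l * w (g⁻¹ * a) ∂μ = ∫ c, π.mat (a * c⁻¹) i l * w c ∂μ := by
          have e1 := integral_mul_left_eq_self (μ := μ) (fun g => π.mat g i l * w (g⁻¹ * a)) a
          rw [← e1, ← integral_inv_eq_self (fun c => π.mat (a * c) i l * w ((a * c)⁻¹ * a)) μ]
          simp
        simp only [h1, π.mat_mul_apply, π.mat_inv_apply, Finset.sum_mul]
        rw [integral_finsetSum _ fun m _ => ?_, Finset.mul_sum]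
        · refine Finset.sum_congr rfl fun m _ => ?_
          rw [fourierCoeff_apply, ← integral_mul_const, ← integral_const_mul]
          exact integral_congr_ae (ae_of_all _ fun c => by simp only; ring)
        · refine ((integrable_mul_conj_mat (integrable_coe μ w) π l m).const_mul
            (π.mat a i m)).congr (ae_of_all _ fun c => by simp only; ring)
    _ = ∑ m, fourierCoeff μ w π m l * inner ℂ f (coeff μ π i m) := by
        rw [integral_finsetSum _ fun m _ => ?_]
        · simp_rw [integral_const_mul, inner_coeff]
        · refine ((integrable_mul_mat (integrable_conj_coe μ f) π i m).const_mul _).congr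
            (ae_of_all _ fun c => by simp only; ring)

/-- One factor `ŵ(π)*` comes from `corr_coeff`, the other factor `ŵ(π)` from
`integral_mat_mul_conj_corr`. Only the product matters, and admissibility controls exactly this
product. -/
theorem integral_corr_coeff_mul_conj_corr (w f : Lp ℂ 2 μ) (π : IrrUnitaryRep G)
    (i j : Fin π.dim) :
    ∫ g, corr μ w (coeff μ π i j) g * (starRingEnd ℂ) (corr μ w f g) ∂μ =
      ∑ m, (fourierCoeff μ w π * (fourierCoeff μ w π).conjTranspose) m j *
        inner ℂ f (coeff μ π i m) := by
  have hc : Continuous fun g => (starRingEnd ℂ) (corr μ w f g) :=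
    RCLike.continuous_conj.comp (continuous_corr_right μ w f)
  simp_rw [corr_coeff, Finset.sum_mul]
  rw [integral_finsetSum _ fun l _ => ?_]
  · have : ∀ l, ∫ g, π.mat g i l * (starRingEnd ℂ) (fourierCoeff μ w π j l) *
        (starRingEnd ℂ) (corr μ w f g) ∂μ = (starRingEnd ℂ) (fourierCoeff μ w π j l) *
          ∑ m, fourierCoeff μ w π m l * inner ℂ f (coeff μ π i m) := fun l => by
      rw [← integral_mat_mul_conj_corr, ← integral_const_mul]
      exact integral_congr_ae (ae_of_all _ fun c => by simp only; ring)
    simp_rw [this, Finset.mul_sum, Matrix.mul_apply, Finset.sum_mul]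
    rw [Finset.sum_comm]
    refine Finset.sum_congr rfl fun m _ => Finset.sum_congr rfl fun l _ => ?_
    rw [Matrix.conjTranspose_apply, RCLike.star_def]
    ring
  · exact (((π.continuous_mat_apply i l).mul continuous_const).mul hc).integrable_of_hasCompactSupport
      (.of_compactSpace _)

/-- The convolution theorem: with `π(g)*` in the Fourier coefficient the order of factors is
reversed, and the involution contributes the adjoint. -/
theorem fourierCoeff_selfConv (w : Lp ℂ 2 μ) (π : IrrUnitaryRep G) :
    fourierCoeff μ (fun g => ∫ y, (starRingEnd ℂ) (w y⁻¹) * w (y⁻¹ * g) ∂μ) π =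
      fourierCoeff μ w π * (fourierCoeff μ w π).conjTranspose := by
  ext i j
  have hint : Integrable (Function.uncurry fun y g : G =>
      (starRingEnd ℂ) (w y) * w (y * g) * (starRingEnd ℂ) (π.mat g j i)) (μ.prod μ) :=
    (integrable_prod_mul_shear (integrable_conj_coe μ w) (integrable_coe μ w)).mul_bdd (c := 1)
      (RCLike.continuous_conj.comp
        ((π.continuous_mat_apply j i).comp continuous_snd)).aestronglyMeasurable
      (ae_of_all _ fun g => by simpa using π.norm_mat_apply_le g.2 j i)
  calc fourierCoeff μ (fun g => ∫ y, (starRingEnd ℂ) (w y⁻¹) * w (y⁻¹ * g) ∂μ) π i j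
      = ∫ g, ∫ y, (starRingEnd ℂ) (w y) * w (y * g) * (starRingEnd ℂ) (π.mat g j i) ∂μ ∂μ := by
        rw [fourierCoeff_apply]
        refine integral_congr_ae (ae_of_all _ fun g => ?_)
        simp only
        rw [integral_mul_const,
          integral_inv_eq_self (fun y => (starRingEnd ℂ) (w y) * w (y * g)) μ]
    _ = ∫ y, (starRingEnd ℂ) (w y) * ∫ g, w (y * g) * (starRingEnd ℂ) (π.mat g j i) ∂μ ∂μ := by
        rw [← integral_integral_swap hint]
        simp_rw [mul_assoc, integral_const_mul]
    _ = ∫ y, ∑ l, fourierCoeff μ w π i l * ((starRingEnd ℂ) (w y) * π.mat y l j) ∂μ := by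
        refine integral_congr_ae (ae_of_all _ fun y => ?_)
        have h1 : ∫ g, w (y * g) * (starRingEnd ℂ) (π.mat g j i) ∂μ =
            ∫ g, w g * (starRingEnd ℂ) (π.mat (y⁻¹ * g) j i) ∂μ := by
          rw [← integral_mul_left_eq_self
            (fun g => w g * (starRingEnd ℂ) (π.mat (y⁻¹ * g) j i)) y]
          simp
        simp only [h1, π.mat_mul_apply, π.mat_inv_apply, Finset.mul_sum, map_sum, map_mul,
          Complex.conj_conj]
        rw [integral_finsetSum _ fun l _ => ?_, Finset.mul_sum]
        · refine Finset.sum_congr rfl fun l _ => ?_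
          rw [fourierCoeff_apply, ← integral_mul_const, ← integral_const_mul]
          exact integral_congr_ae (ae_of_all _ fun c => by simp only; ring)
        · refine ((integrable_mul_conj_mat (integrable_coe μ w) π l i).const_mul
            (π.mat y l j)).congr (ae_of_all _ fun c => by simp only; ring)
    _ = (fourierCoeff μ w π * (fourierCoeff μ w π).conjTranspose) i j := by
        rw [integral_finsetSum _ fun l _ =>
          (integrable_mul_mat (integrable_conj_coe μ w) π l j).const_mul _]
        simp_rw [integral_const_mul, Matrix.mul_apply, Matrix.conjTranspose_apply, RCLike.star_def,
          conj_fourierCoeff_apply]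

end Core

instance secondCountableTopology_subgroup {G : Type*} [Group G] [TopologicalSpace G]
    [SecondCountableTopology G] (H : Subgroup G) : SecondCountableTopology H :=
  TopologicalSpace.Subtype.secondCountableTopology _

/-! ### Averaging over the stabiliser -/

section SubgroupAverage

variable {G : Type*} [Group G] [TopologicalSpace G] [IsTopologicalGroup G]
    [CompactSpace G] [T2Space G] [SecondCountableTopology G] [MeasurableSpace G] [BorelSpace G]
    (μ : Measure G) [μ.IsHaarMeasure] [IsProbabilityMeasure μ]
    {H : Subgroup G} (ν : Measure H) [IsProbabilityMeasure ν]

/-- The matrix `∫_H π(h) dν(h)`. -/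
noncomputable def subgroupAverage (π : IrrUnitaryRep G) : Matrix (Fin π.dim) (Fin π.dim) ℂ :=
  Matrix.of fun i j => ∫ h : H, π.mat h i j ∂ν

theorem continuous_mat_coe (π : IrrUnitaryRep G) (i j : Fin π.dim) :
    Continuous fun h : H => π.mat h i j :=
  (π.continuous_mat_apply i j).comp continuous_subtype_val

theorem integrable_mat_coe (π : IrrUnitaryRep G) (i j : Fin π.dim) :
    Integrable (fun h : H => π.mat h i j) ν :=
  .of_bound (continuous_mat_coe π i j).aestronglyMeasurable 1
    (ae_of_all _ fun h => π.norm_mat_apply_le h i j)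

theorem integrable_mat_mul_mat (π : IrrUnitaryRep G) (i j k l : Fin π.dim) :
    Integrable (fun z : H × H => π.mat z.1 i j * π.mat z.2 k l) (ν.prod ν) :=
  (integrable_mat_coe ν π i j).mul_prod (integrable_mat_coe ν π k l)

theorem integral_mat_mul_mat (π : IrrUnitaryRep G) (i j k l : Fin π.dim) :
    ∫ z : H × H, π.mat z.1 i j * π.mat z.2 k l ∂(ν.prod ν) =
      subgroupAverage ν π i j * subgroupAverage ν π k l :=
  integral_prod_mul (fun h : H => π.mat h i j) (fun h : H => π.mat h k l)

theorem integral_conj_translate (p : G → ℂ) (hp : Integrable p μ) (π : IrrUnitaryRep G)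
    (i j : Fin π.dim) (a b : G) :
    ∫ g, p (a * g * b) * (starRingEnd ℂ) (π.mat g j i) ∂μ =
      ∑ m, ∑ l, fourierCoeff μ p π m l * (π.mat b i m * π.mat a l j) := by
  have h1 : ∫ g, p (a * g * b) * (starRingEnd ℂ) (π.mat g j i) ∂μ =
      ∫ g, p g * (starRingEnd ℂ) (π.mat (a⁻¹ * g * b⁻¹) j i) ∂μ := by
    rw [← integral_mul_left_eq_self
        (fun g => p g * (starRingEnd ℂ) (π.mat (a⁻¹ * g * b⁻¹) j i)) a,
      ← integral_mul_right_eq_self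
        (fun g => p (a * g) * (starRingEnd ℂ) (π.mat (a⁻¹ * (a * g) * b⁻¹) j i)) b]
    simp [mul_assoc]
  have h2 : ∀ g, p g * (starRingEnd ℂ) (π.mat (a⁻¹ * g * b⁻¹) j i) =
      ∑ m, ∑ l, (π.mat b i m * π.mat a l j) * (p g * (starRingEnd ℂ) (π.mat g l m)) := fun g => by
    simp only [π.mat_mul_apply, π.mat_inv_apply, Finset.sum_mul, Finset.mul_sum, map_sum, map_mul,
      Complex.conj_conj]
    exact Finset.sum_congr rfl fun m _ => Finset.sum_congr rfl fun l _ => by ring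
  simp_rw [h1, h2]
  have h3 : ∀ m l, Integrable (fun g => (π.mat b i m * π.mat a l j) *
      (p g * (starRingEnd ℂ) (π.mat g l m))) μ := fun m l =>
    (integrable_mul_conj_mat hp π l m).const_mul _
  rw [integral_finsetSum _ fun m _ => integrable_finsetSum _ fun l _ => h3 m l]
  refine Finset.sum_congr rfl fun m _ => ?_
  rw [integral_finsetSum _ fun l _ => h3 m l]
  refine Finset.sum_congr rfl fun l _ => ?_
  rw [integral_const_mul, fourierCoeff_apply, mul_comm]

theorem integrable_biTranslate {p : G → ℂ} (hp : Integrable p μ) :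
    Integrable (fun z : (H × H) × G => p ((z.1.2 : G) * z.2 * (z.1.1 : G)))
      ((ν.prod ν).prod μ) := by
  have h : MeasurePreserving (fun z : (H × H) × G => (z.1, (z.1.2 : G) * z.2 * (z.1.1 : G)))
      ((ν.prod ν).prod μ) ((ν.prod ν).prod μ) :=
    (MeasurePreserving.id (ν.prod ν)).skew_product (g := fun z g => (z.2 : G) * g * (z.1 : G))
      ((by fun_prop : Continuous fun z : (H × H) × G =>
        (z.1.2 : G) * z.2 * (z.1.1 : G)).measurable)
      (ae_of_all _ fun z => ((measurePreserving_mul_right μ (z.1 : G)).comp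
        (measurePreserving_mul_left μ (z.2 : G))).map_eq)
  exact h.integrable_comp_of_integrable (hp.comp_snd (ν.prod ν))

/-- Left and right translation of `p` multiply `p̂(π)` by unitary matrices on either side; averaging
them over `H` replaces each by `subgroupAverage`. -/
theorem fourierCoeff_biAverage {p : G → ℂ} (hp : Integrable p μ) (π : IrrUnitaryRep G) :
    fourierCoeff μ (fun g => ∫ h₂ : H, ∫ h₁ : H, p ((h₁ : G) * g * (h₂ : G)) ∂ν ∂ν) π =
      subgroupAverage ν π * fourierCoeff μ p π * subgroupAverage ν π := by
  ext i j
  have hI := integrable_biTranslate μ ν hp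
  have hint : Integrable (Function.uncurry fun (z : H × H) (g : G) =>
      p ((z.2 : G) * g * (z.1 : G)) * (starRingEnd ℂ) (π.mat g j i)) ((ν.prod ν).prod μ) :=
    hI.mul_bdd (c := 1) (RCLike.continuous_conj.comp
        ((π.continuous_mat_apply j i).comp continuous_snd)).aestronglyMeasurable
      (ae_of_all _ fun g => by simpa using π.norm_mat_apply_le g.2 j i)
  calc fourierCoeff μ (fun g => ∫ h₂ : H, ∫ h₁ : H, p ((h₁ : G) * g * (h₂ : G)) ∂ν ∂ν) π i j
      = ∫ g, ∫ z : H × H, p ((z.2 : G) * g * (z.1 : G)) * (starRingEnd ℂ) (π.mat g j i)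
          ∂(ν.prod ν) ∂μ := by
        rw [fourierCoeff_apply]
        refine integral_congr_ae ?_
        -- As `p` is merely integrable, the iterated integral over `H` agrees with the integral over
        -- `H × H` only for almost every `g`.
        filter_upwards [hI.prod_left_ae] with g hg
        rw [integral_mul_const, integral_prod _ hg]
    _ = ∫ z : H × H, ∑ m, ∑ l, fourierCoeff μ p π m l * (π.mat z.1 i m * π.mat z.2 l j)
          ∂(ν.prod ν) := by
        rw [← integral_integral_swap hint]
        simp_rw [integral_conj_translate μ p hp]
    _ = (subgroupAverage ν π * fourierCoeff μ p π * subgroupAverage ν π) i j := by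
        have h3 : ∀ m l, Integrable (fun z : H × H => fourierCoeff μ p π m l *
            (π.mat z.1 i m * π.mat z.2 l j)) (ν.prod ν) := fun m l =>
          (integrable_mat_mul_mat ν π i m l j).const_mul _
        rw [integral_finsetSum _ fun m _ => integrable_finsetSum _ fun l _ => h3 m l]
        simp_rw [integral_finsetSum _ fun l _ => h3 _ l, integral_const_mul, integral_mat_mul_mat,
          Matrix.mul_apply, Finset.sum_mul]
        rw [Finset.sum_comm]
        exact Finset.sum_congr rfl fun m _ => Finset.sum_congr rfl fun l _ => by ring

theorem inner_rightTranslate_coeff (f : Lp ℂ 2 μ) (π : IrrUnitaryRep G) (i j : Fin π.dim)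
    (h : G) : inner ℂ f (rightTranslate μ h (coeff μ π i j)) =
      ∑ m, π.mat h m j * inner ℂ f (coeff μ π i m) := by
  calc inner ℂ f (rightTranslate μ h (coeff μ π i j))
      = ∫ a, ∑ m, π.mat h m j * (π.mat a i m * (starRingEnd ℂ) (f a)) ∂μ := by
        rw [L2.inner_def]
        refine integral_congr_ae ?_
        filter_upwards [coeFn_rightTranslate μ h (coeff μ π i j),
          (measurePreserving_mul_right μ h).quasiMeasurePreserving.ae (coeFn_coeff μ π i j)]
          with a ha hb
        rw [ha, hb, RCLike.inner_apply, π.mat_mul_apply, Finset.sum_mul]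
        exact Finset.sum_congr rfl fun m _ => by ring
    _ = ∑ m, π.mat h m j * inner ℂ f (coeff μ π i m) := by
        rw [integral_finsetSum _ fun m _ => ?_]
        · simp_rw [integral_const_mul, inner_coeff]
        · refine ((integrable_mul_mat (integrable_conj_coe μ f) π i m).const_mul _).congr
            (ae_of_all _ fun c => by simp only; ring)

/-- The function `(h₁, h₂) ↦ ⟨f₂, f₁ (· h₁ h₂)⟩`, whose mean is the pairing of `f₂` with the
average of `f₁` over right cosets. -/
noncomputable def translatePairing (f₂ f₁ : Lp ℂ 2 μ) (z : H × H) : ℂ :=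
  inner ℂ f₂ (rightTranslate μ ((z.1 : G) * (z.2 : G)) f₁)

theorem translatePairing_coeff (f : Lp ℂ 2 μ) (π : IrrUnitaryRep G) (i j : Fin π.dim) :
    translatePairing μ (H := H) f (coeff μ π i j) = fun z =>
      ∑ m, ∑ l, (π.mat z.1 m l * π.mat z.2 l j) * inner ℂ f (coeff μ π i m) := by
  funext z
  rw [translatePairing, inner_rightTranslate_coeff]
  simp_rw [π.mat_mul_apply, Finset.sum_mul]

theorem integrable_translatePairing_coeff (f : Lp ℂ 2 μ) (π : IrrUnitaryRep G)
    (i j : Fin π.dim) : Integrable (translatePairing μ f (coeff μ π i j)) (ν.prod ν) := by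
  rw [translatePairing_coeff]
  exact integrable_finsetSum _ fun m _ => integrable_finsetSum _ fun l _ =>
    (integrable_mat_mul_mat ν π m l l j).mul_const _

/-- Averaging over `H × H` instead of `H` yields the square of `subgroupAverage`, which is the form
in which the limit of `P p̂_t P` arises. -/
theorem integral_translatePairing_coeff (f : Lp ℂ 2 μ) (π : IrrUnitaryRep G)
    (i j : Fin π.dim) : ∫ z, translatePairing μ f (coeff μ π i j) z ∂(ν.prod ν) =
      ∑ m, (subgroupAverage ν π * subgroupAverage ν π) m j * inner ℂ f (coeff μ π i m) := by
  rw [translatePairing_coeff]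
  have h3 : ∀ m l, Integrable (fun z : H × H =>
      (π.mat z.1 m l * π.mat z.2 l j) * inner ℂ f (coeff μ π i m)) (ν.prod ν) := fun m l =>
    (integrable_mat_mul_mat ν π m l l j).mul_const _
  rw [integral_finsetSum _ fun m _ => integrable_finsetSum _ fun l _ => h3 m l]
  simp_rw [integral_finsetSum _ fun l _ => h3 _ l, integral_mul_const, integral_mat_mul_mat,
    Matrix.mul_apply, Finset.sum_mul]

theorem norm_integral_translatePairing_le (f : Lp ℂ 2 μ) :
    ‖∫ z, translatePairing μ f f z ∂(ν.prod ν)‖ ≤ ‖f‖ ^ 2 := by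
  refine (norm_integral_le_of_norm_le_const (C := ‖f‖ ^ 2) (ae_of_all _ fun z => ?_)).trans
    (by simp)
  refine (norm_inner_le_norm _ _).trans ?_
  rw [LinearIsometry.norm_map, sq]

/-- Translating both arguments preserves the inner product, and `f₂` is fixed, so the integrand is
constant. -/
theorem integral_translatePairing_of_invariant {f₂ : Lp ℂ 2 μ}
    (hf : ∀ h : H, rightTranslate μ (h : G) f₂ = f₂) (f₁ : Lp ℂ 2 μ) :
    ∫ z, translatePairing μ f₂ f₁ z ∂(ν.prod ν) = inner ℂ f₂ f₁ := by
  have : translatePairing μ (H := H) f₂ f₁ = fun _ => inner ℂ f₂ f₁ := by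
    funext z
    have h := hf (z.1 * z.2)
    rw [translatePairing]
    nth_rewrite 1 [← h]
    exact LinearIsometry.inner_map_map _ _ _
  simp [this]

end SubgroupAverage

/-! ### Reproduction of matrix coefficients and of their span -/

section Pairing

variable {G : Type*} [Group G] [TopologicalSpace G] [IsTopologicalGroup G]
    [CompactSpace G] [T2Space G] [SecondCountableTopology G] [MeasurableSpace G] [BorelSpace G]
    (μ : Measure G) [μ.IsHaarMeasure] [IsProbabilityMeasure μ]
    {H : Subgroup G} (ν : Measure H) [IsProbabilityMeasure ν]
    (s : Measure ℝ) (w : ℝ → Lp ℂ 2 μ)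

/-- The `L²(G)` pairing of the correlations of `f₁` and `f₂` with the same window. -/
noncomputable def corrPairing (f₂ f₁ v : Lp ℂ 2 μ) : ℂ :=
  ∫ g, corr μ v f₁ g * (starRingEnd ℂ) (corr μ v f₂ g) ∂μ

theorem integrable_corr_mul_conj_corr (f₂ f₁ v : Lp ℂ 2 μ) :
    Integrable (fun g => corr μ v f₁ g * (starRingEnd ℂ) (corr μ v f₂ g)) μ :=
  ((continuous_corr_right μ v f₁).mul (RCLike.continuous_conj.comp
    (continuous_corr_right μ v f₂))).integrable_of_hasCompactSupport (.of_compactSpace _)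

theorem corrPairing_add (f₂ f f' v : Lp ℂ 2 μ) :
    corrPairing μ f₂ (f + f') v = corrPairing μ f₂ f v + corrPairing μ f₂ f' v := by
  simp_rw [corrPairing, corr_add, add_mul]
  exact integral_add (integrable_corr_mul_conj_corr μ f₂ f v)
    (integrable_corr_mul_conj_corr μ f₂ f' v)

theorem corrPairing_smul (f₂ f v : Lp ℂ 2 μ) (c : ℂ) :
    corrPairing μ f₂ (c • f) v = c * corrPairing μ f₂ f v := by
  simp_rw [corrPairing, corr_smul, mul_assoc, integral_const_mul]

/-- `f₁` is reproduced by the window family `w`, up to averaging over `H`, when tested against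
arbitrary elements of `L²(G)`. -/
def IsReproduced (f₁ : Lp ℂ 2 μ) : Prop :=
  ∀ f₂ : Lp ℂ 2 μ, Integrable (translatePairing μ f₂ f₁) (ν.prod ν) ∧
    (∀ t : ℝ, 0 < t → IntegrableOn (fun ρ => corrPairing μ f₂ f₁ (w ρ)) (Ioi t) s) ∧
    Tendsto (fun t => ∫ ρ in Ioi t, corrPairing μ f₂ f₁ (w ρ) ∂s) (𝓝[>] 0)
      (𝓝 (∫ z, translatePairing μ f₂ f₁ z ∂(ν.prod ν)))

variable {μ ν s w}

theorem IsReproduced.add {f f' : Lp ℂ 2 μ} (h : IsReproduced μ ν s w f)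
    (h' : IsReproduced μ ν s w f') : IsReproduced μ ν s w (f + f') := by
  intro f₂
  obtain ⟨a, b, c⟩ := h f₂
  obtain ⟨a', b', c'⟩ := h' f₂
  have e : translatePairing μ (H := H) f₂ (f + f') =
      fun z => translatePairing μ f₂ f z + translatePairing μ f₂ f' z := by
    funext z
    simp only [translatePairing, map_add, inner_add_right]
  simp only [e, corrPairing_add]
  refine ⟨a.add a', fun t ht => (b t ht).add (b' t ht), ?_⟩
  rw [integral_add a a']
  refine (c.add c').congr' ?_
  filter_upwards [self_mem_nhdsWithin] with t ht
  exact (integral_add (b t ht) (b' t ht)).symm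

theorem IsReproduced.smul {f : Lp ℂ 2 μ} (h : IsReproduced μ ν s w f) (r : ℂ) :
    IsReproduced μ ν s w (r • f) := by
  intro f₂
  obtain ⟨a, b, c⟩ := h f₂
  have e : translatePairing μ (H := H) f₂ (r • f) = fun z => r * translatePairing μ f₂ f z := by
    funext z
    simp only [translatePairing, map_smul, inner_smul_right]
  simp only [e, corrPairing_smul]
  refine ⟨a.const_mul r, fun t ht => (b t ht).const_mul r, ?_⟩
  simp_rw [integral_const_mul]
  exact c.const_mul r

variable (μ ν s w) in
theorem isReproduced_zero : IsReproduced μ ν s w 0 := by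
  intro f₂
  have e : translatePairing μ (H := H) f₂ 0 = fun _ => 0 := by
    funext z
    simp only [translatePairing, map_zero, inner_zero_right]
  have e' : ∀ v, corrPairing μ f₂ 0 v = 0 := fun v => by simp [corrPairing, corr]
  simp [e, e']

theorem isReproduced_sum {ι : Type*} {t : Finset ι} {f : ι → Lp ℂ 2 μ}
    (h : ∀ i ∈ t, IsReproduced μ ν s w (f i)) : IsReproduced μ ν s w (∑ i ∈ t, f i) :=
  Finset.sum_induction f _ (fun _ _ => IsReproduced.add) (isReproduced_zero μ ν s w) h

theorem isReproduced_coeff (π : IrrUnitaryRep G)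
    (hint : ∀ t : ℝ, 0 < t → ∀ i j, IntegrableOn (fun ρ =>
      (fourierCoeff μ (w ρ) π * (fourierCoeff μ (w ρ) π).conjTranspose) i j) (Ioi t) s)
    (hlim : ∀ i j, Tendsto (fun t => ∫ ρ in Ioi t,
      (fourierCoeff μ (w ρ) π * (fourierCoeff μ (w ρ) π).conjTranspose) i j ∂s) (𝓝[>] 0)
        (𝓝 ((subgroupAverage ν π * subgroupAverage ν π) i j)))
    (i j : Fin π.dim) : IsReproduced μ ν s w (coeff μ π i j) := by
  intro f₂
  have e : ∀ ρ, corrPairing μ f₂ (coeff μ π i j) (w ρ) = _ := fun ρ =>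
    integral_corr_coeff_mul_conj_corr μ (w ρ) f₂ π i j
  simp only [e]
  have hI : ∀ t : ℝ, 0 < t → ∀ m, IntegrableOn (fun ρ =>
      (fourierCoeff μ (w ρ) π * (fourierCoeff μ (w ρ) π).conjTranspose) m j *
        inner ℂ f₂ (coeff μ π i m)) (Ioi t) s := fun t ht m => (hint t ht m j).mul_const _
  refine ⟨integrable_translatePairing_coeff μ ν f₂ π i j,
    fun t ht => integrable_finsetSum _ fun m _ => hI t ht m, ?_⟩
  rw [integral_translatePairing_coeff]
  refine (tendsto_finsetSum _ fun m _ => (hlim m j).mul_const _).congr' ?_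
  filter_upwards [self_mem_nhdsWithin] with t ht
  rw [integral_finsetSum _ fun m _ => hI t ht m]
  simp_rw [integral_mul_const]

end Pairing

/-! ### The analysis operator: contraction on the closure, isometry on invariant functions -/

section Analysis

variable {G : Type*} [Group G] [TopologicalSpace G] [IsTopologicalGroup G]
    [CompactSpace G] [T2Space G] [SecondCountableTopology G] [MeasurableSpace G] [BorelSpace G]
    (μ : Measure G) [μ.IsHaarMeasure] [IsProbabilityMeasure μ]
    {H : Subgroup G} {ν : Measure H} [IsProbabilityMeasure ν]
    {s : Measure ℝ} [SFinite s] {w : ℝ → Lp ℂ 2 μ}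

/-- The wavelet transform on the group with respect to the window family `w`. -/
noncomputable def analysis (w : ℝ → Lp ℂ 2 μ) (f : Lp ℂ 2 μ) : ℝ × G → ℂ :=
  fun z => corr μ (w z.1) f z.2

variable {μ}

theorem aestronglyMeasurable_analysis (hw : AEStronglyMeasurable w s) (f : Lp ℂ 2 μ) :
    AEStronglyMeasurable (analysis μ w f) (s.prod μ) := by
  have h : AEStronglyMeasurable (fun z : ℝ × G => (z.2, w z.1)) (s.prod μ) :=
    measurable_snd.aestronglyMeasurable.prodMk hw.comp_fst
  have h2 := (continuous_corr μ f).comp_aestronglyMeasurable h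
  exact h2

theorem corrPairing_self (f v : Lp ℂ 2 μ) :
    corrPairing μ f f v = ((∫ g, ‖corr μ v f g‖ ^ 2 ∂μ : ℝ) : ℂ) := by
  rw [corrPairing, ← integral_complex_ofReal]
  refine integral_congr_ae (ae_of_all _ fun g => ?_)
  simp only [Complex.mul_conj, Complex.normSq_eq_norm_sq]

theorem aecover_Ioi_one_div (hs : s.restrict (Ioi 0) = s) :
    AECover s atTop fun n : ℕ => Ioi (1 / ((n : ℝ) + 1)) := by
  rw [← hs]
  exact aecover_Ioi_of_Ioi tendsto_one_div_add_atTop_nhds_zero_nat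

theorem tendsto_one_div_nhdsGT :
    Tendsto (fun n : ℕ => 1 / ((n : ℝ) + 1)) atTop (𝓝[>] 0) :=
  tendsto_nhdsWithin_iff.mpr ⟨tendsto_one_div_add_atTop_nhds_zero_nat,
    .of_forall fun n => mem_Ioi.mpr (by positivity)⟩

/-- For `f₂ = f₁ = f` the pairings are nonnegative, so convergence of their integrals over
`(1/(n+1), ∞)` gives integrability on the whole half-line. The limit is an average of `⟨f, f(· h)⟩`,
bounded by `‖f‖²`. -/
theorem IsReproduced.eLpNorm_analysis_le {f : Lp ℂ 2 μ} (hf : IsReproduced μ ν s w f)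
    (hw : AEStronglyMeasurable w s) (hs : s.restrict (Ioi 0) = s) :
    eLpNorm (analysis μ w f) 2 (s.prod μ) ≤ ENNReal.ofReal ‖f‖ := by
  obtain ⟨-, hI, hT⟩ := hf f
  simp only [corrPairing_self] at hI hT
  set F : ℝ → ℝ := fun ρ => ∫ g, ‖corr μ (w ρ) f g‖ ^ 2 ∂μ with hF
  have hI' : ∀ t : ℝ, 0 < t → IntegrableOn F (Ioi t) s := fun t ht => by
    exact (hI t ht).re
  have hF0 : ∀ ρ, 0 ≤ F ρ := fun ρ => integral_nonneg fun g => by positivity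
  have hT' : Tendsto (fun n : ℕ => ∫ ρ in Ioi (1 / ((n : ℝ) + 1)), F ρ ∂s) atTop
      (𝓝 (∫ z, translatePairing μ f f z ∂(ν.prod ν)).re) := by
    refine ((Complex.continuous_re.tendsto _).comp (hT.comp tendsto_one_div_nhdsGT)).congr
      fun n => ?_
    simp only [Function.comp_apply, integral_complex_ofReal, Complex.ofReal_re, hF]
  have hcov := aecover_Ioi_one_div (s := s) hs
  have hFi : Integrable F s := hcov.integrable_of_integral_tendsto_of_nonneg_ae _
    (fun n => hI' _ (by positivity)) (ae_of_all _ hF0) hT'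
  have hle : ∫ ρ, F ρ ∂s ≤ ‖f‖ ^ 2 := by
    rw [tendsto_nhds_unique (hcov.integral_tendsto_of_countably_generated hFi) hT']
    exact (Complex.re_le_norm _).trans (norm_integral_translatePairing_le μ ν f)
  have hsq : eLpNorm (analysis μ w f) 2 (s.prod μ) ^ 2 ≤ ENNReal.ofReal ‖f‖ ^ 2 := by
    have h1 : eLpNorm (analysis μ w f) 2 (s.prod μ) ^ 2 =
        ∫⁻ z, ‖analysis μ w f z‖ₑ ^ 2 ∂(s.prod μ) := by
      have := eLpNorm_nnreal_pow_eq_lintegral (f := analysis μ w f) (μ := s.prod μ) (p := 2)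
        (by norm_num)
      simpa using this
    rw [h1, lintegral_prod _ ((aestronglyMeasurable_analysis hw f).enorm.pow_const 2),
      ← ENNReal.ofReal_pow (norm_nonneg _)]
    calc ∫⁻ ρ, ∫⁻ g, ‖analysis μ w f (ρ, g)‖ₑ ^ 2 ∂μ ∂s = ∫⁻ ρ, ENNReal.ofReal (F ρ) ∂s := by
          refine lintegral_congr fun ρ => ?_
          rw [hF, ofReal_integral_eq_lintegral_ofReal _ (ae_of_all _ fun g => by positivity)]
          · refine lintegral_congr fun g => ?_
            rw [ENNReal.ofReal_pow (norm_nonneg _), ofReal_norm]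
            rfl
          · exact ((continuous_corr_right μ (w ρ) f).norm.pow 2).integrable_of_hasCompactSupport
              (.of_compactSpace _)
      _ = ENNReal.ofReal (∫ ρ, F ρ ∂s) :=
          (ofReal_integral_eq_lintegral_ofReal hFi (ae_of_all _ hF0)).symm
      _ ≤ ENNReal.ofReal (‖f‖ ^ 2) := ENNReal.ofReal_le_ofReal hle
  exact (ENNReal.pow_le_pow_left_iff two_ne_zero).mp hsq

/-- Correlations converge pointwise under `L²` convergence of `f`, so Fatou carries the bound over.
-/
theorem eLpNorm_analysis_le_of_mem_closure {K : Submodule ℂ (Lp ℂ 2 μ)}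
    (hK : ∀ f ∈ K, IsReproduced μ ν s w f) (hw : AEStronglyMeasurable w s)
    (hs : s.restrict (Ioi 0) = s) {f : Lp ℂ 2 μ} (hf : f ∈ K.topologicalClosure) :
    eLpNorm (analysis μ w f) 2 (s.prod μ) ≤ ENNReal.ofReal ‖f‖ := by
  obtain ⟨u, huK, hu⟩ := mem_closure_iff_seq_limit.mp hf
  refine (Lp.eLpNorm_lim_le_liminf_eLpNorm
    (fun n => aestronglyMeasurable_analysis hw (u n)) _ (ae_of_all _ fun z =>
      ((continuous_corr_snd μ (w z.1) z.2).tendsto f).comp hu)).trans ?_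
  have hlim : Tendsto (fun n => ENNReal.ofReal ‖u n‖) atTop (𝓝 (ENNReal.ofReal ‖f‖)) :=
    ENNReal.tendsto_ofReal hu.norm
  rw [← hlim.liminf_eq]
  exact liminf_le_liminf (.of_forall fun n => (hK _ (huK n)).eLpNorm_analysis_le hw hs)

theorem memLp_analysis {K : Submodule ℂ (Lp ℂ 2 μ)}
    (hK : ∀ f ∈ K, IsReproduced μ ν s w f) (hw : AEStronglyMeasurable w s)
    (hs : s.restrict (Ioi 0) = s) {f : Lp ℂ 2 μ} (hf : f ∈ K.topologicalClosure) :
    MemLp (analysis μ w f) 2 (s.prod μ) :=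
  ⟨aestronglyMeasurable_analysis hw f,
    (eLpNorm_analysis_le_of_mem_closure hK hw hs hf).trans_lt ENNReal.ofReal_lt_top⟩

/-- The analysis operator as a contraction on the closure of a space of reproduced functions. -/
noncomputable def analysisCLM {K : Submodule ℂ (Lp ℂ 2 μ)}
    (hK : ∀ f ∈ K, IsReproduced μ ν s w f) (hw : AEStronglyMeasurable w s)
    (hs : s.restrict (Ioi 0) = s) : K.topologicalClosure →L[ℂ] Lp ℂ 2 (s.prod μ) :=
  LinearMap.mkContinuous
    { toFun := fun f => (memLp_analysis hK hw hs f.2).toLp _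
      map_add' := fun f f' => by
        rw [← MemLp.toLp_add]
        exact MemLp.toLp_congr _ _ (ae_of_all _ fun z => corr_add μ _ _ _ _)
      map_smul' := fun c f => by
        rw [RingHom.id_apply, ← MemLp.toLp_const_smul]
        exact MemLp.toLp_congr _ _ (ae_of_all _ fun z => corr_smul μ _ _ _ _) }
    1 fun f => by
      rw [one_mul]
      simp only [LinearMap.coe_mk, AddHom.coe_mk]
      rw [Lp.norm_toLp]
      exact ENNReal.toReal_le_of_le_ofReal (norm_nonneg _)
        (eLpNorm_analysis_le_of_mem_closure hK hw hs f.2)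

theorem coeFn_analysisCLM {K : Submodule ℂ (Lp ℂ 2 μ)}
    (hK : ∀ f ∈ K, IsReproduced μ ν s w f) (hw : AEStronglyMeasurable w s)
    (hs : s.restrict (Ioi 0) = s) (f : K.topologicalClosure) :
    analysisCLM hK hw hs f =ᵐ[s.prod μ] analysis μ w f :=
  MemLp.coeFn_toLp (memLp_analysis hK hw hs f.2)

/-- Both transforms are now known to be square integrable, so the truncated integrals converge to
the full inner product; `IsReproduced` supplies their limit. -/
theorem inner_analysisCLM {K : Submodule ℂ (Lp ℂ 2 μ)}
    (hK : ∀ f ∈ K, IsReproduced μ ν s w f) (hw : AEStronglyMeasurable w s)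
    (hs : s.restrict (Ioi 0) = s) (f₂ f₁ : K.topologicalClosure) (hf₁ : (f₁ : Lp ℂ 2 μ) ∈ K) :
    inner ℂ (analysisCLM hK hw hs f₂) (analysisCLM hK hw hs f₁) =
      ∫ z, translatePairing μ (f₂ : Lp ℂ 2 μ) f₁ z ∂(ν.prod ν) := by
  have hae : (fun z => inner ℂ (analysisCLM hK hw hs f₂ z) (analysisCLM hK hw hs f₁ z))
      =ᵐ[s.prod μ] fun z => analysis μ w f₁ z * (starRingEnd ℂ) (analysis μ w f₂ z) := by
    filter_upwards [coeFn_analysisCLM hK hw hs f₁, coeFn_analysisCLM hK hw hs f₂] with z h1 h2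
    rw [h1, h2, RCLike.inner_apply]
  have hi := (L2.integrable_inner (𝕜 := ℂ) (analysisCLM hK hw hs f₂)
    (analysisCLM hK hw hs f₁)).congr hae
  rw [L2.inner_def, integral_congr_ae hae, integral_prod _ hi]
  have hi2 := hi.integral_prod_left
  exact tendsto_nhds_unique
    ((aecover_Ioi_one_div (s := s) hs).integral_tendsto_of_countably_generated hi2)
    ((hK _ hf₁ f₂).2.2.comp tendsto_one_div_nhdsGT)

/-- Only `f` is invariant, not its approximants in `K`; the mixed pairing of `f` with an approximant
is enough. -/
theorem eLpNorm_analysis_eq {K : Submodule ℂ (Lp ℂ 2 μ)}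
    (hK : ∀ f ∈ K, IsReproduced μ ν s w f) (hw : AEStronglyMeasurable w s)
    (hs : s.restrict (Ioi 0) = s) {f : Lp ℂ 2 μ} (hf : f ∈ K.topologicalClosure)
    (hinv : ∀ h : H, rightTranslate μ (h : G) f = f) :
    eLpNorm (analysis μ w f) 2 (s.prod μ) = ENNReal.ofReal ‖f‖ := by
  obtain ⟨u, huK, hu⟩ := mem_closure_iff_seq_limit.mp hf
  set V := analysisCLM hK hw hs
  let f' : K.topologicalClosure := ⟨f, hf⟩
  let u' : ℕ → K.topologicalClosure := fun n => ⟨u n, K.le_topologicalClosure (huK n)⟩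
  have hu' : Tendsto u' atTop (𝓝 f') := tendsto_subtype_rng.mpr hu
  have h1 : Tendsto (fun n => inner ℂ (V f') (V (u' n))) atTop (𝓝 (inner ℂ (V f') (V f'))) :=
    tendsto_const_nhds.inner ((V.continuous.tendsto f').comp hu')
  have h2 : Tendsto (fun n => inner ℂ (V f') (V (u' n))) atTop (𝓝 (inner ℂ f f)) := by
    refine (tendsto_const_nhds.inner hu).congr fun n => ?_
    rw [inner_analysisCLM hK hw hs f' (u' n) (huK n),
      integral_translatePairing_of_invariant μ ν hinv]
  have h3 := tendsto_nhds_unique h1 h2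
  rw [inner_self_eq_norm_sq_to_K, inner_self_eq_norm_sq_to_K] at h3
  have h4 : ‖V f'‖ = ‖f‖ := by
    have h5 : ‖V f'‖ ^ 2 = ‖f‖ ^ 2 := by exact_mod_cast h3
    exact (sq_eq_sq₀ (norm_nonneg _) (norm_nonneg _)).mp h5
  rw [← h4, ← eLpNorm_congr_ae (coeFn_analysisCLM hK hw hs f'), ofReal_norm, Lp.enorm_def]

end Analysis

/-! ### The weight `α` as a density -/

section ScaleMeasure

variable {α : ℝ → ℝ}

theorem scaleMeasure_restrict_Ioi {t : ℝ} (ht : 0 ≤ t) :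
    (scaleMeasure α).restrict (Ioi t) =
      (volume.restrict (Ioi t)).withDensity fun ρ => ENNReal.ofReal (α ρ) := by
  rw [scaleMeasure, restrict_withDensity measurableSet_Ioi,
    Measure.restrict_restrict measurableSet_Ioi, inter_eq_left.mpr (Ioi_subset_Ioi ht)]

theorem scaleMeasure_restrict_Ioi_zero : (scaleMeasure α).restrict (Ioi 0) = scaleMeasure α :=
  scaleMeasure_restrict_Ioi le_rfl

theorem ae_scaleMeasure_pos : ∀ᵐ ρ ∂(scaleMeasure α), 0 < ρ := by
  rw [← scaleMeasure_restrict_Ioi_zero]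
  exact ae_restrict_mem measurableSet_Ioi

theorem toReal_ofReal_smul_ae (hα : ∀ ρ : ℝ, 0 < ρ → 0 ≤ α ρ) (F : ℝ → ℂ) {t : ℝ} (ht : 0 ≤ t) :
    (fun ρ => (ENNReal.ofReal (α ρ)).toReal • F ρ) =ᵐ[volume.restrict (Ioi t)]
      fun ρ => F ρ * (α ρ : ℂ) := by
  filter_upwards [ae_restrict_mem measurableSet_Ioi] with ρ hρ
  rw [ENNReal.toReal_ofReal (hα ρ (ht.trans_lt hρ)), Complex.real_smul, mul_comm]

theorem integrableOn_scaleMeasure_iff (hm : Measurable α) (hα : ∀ ρ : ℝ, 0 < ρ → 0 ≤ α ρ)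
    (F : ℝ → ℂ) {t : ℝ} (ht : 0 ≤ t) :
    IntegrableOn F (Ioi t) (scaleMeasure α) ↔
      IntegrableOn (fun ρ => F ρ * (α ρ : ℂ)) (Ioi t) := by
  rw [IntegrableOn, scaleMeasure_restrict_Ioi ht,
    integrable_withDensity_iff_integrable_smul' hm.ennreal_ofReal
      (ae_of_all _ fun _ => ENNReal.ofReal_lt_top),
    integrable_congr (toReal_ofReal_smul_ae hα F ht), IntegrableOn]

theorem setIntegral_scaleMeasure (hm : Measurable α) (hα : ∀ ρ : ℝ, 0 < ρ → 0 ≤ α ρ)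
    (F : ℝ → ℂ) {t : ℝ} (ht : 0 ≤ t) :
    ∫ ρ in Ioi t, F ρ ∂(scaleMeasure α) = ∫ ρ in Ioi t, F ρ * (α ρ : ℂ) := by
  rw [scaleMeasure_restrict_Ioi ht, integral_withDensity_eq_integral_toReal_smul
    hm.ennreal_ofReal (ae_of_all _ fun _ => ENNReal.ofReal_lt_top),
    integral_congr_ae (toReal_ofReal_smul_ae hα F ht)]

end ScaleMeasure

/-! ### Transfer between `X` and `G` -/

section HomogeneousSpace

variable {G : Type*} [Group G] [TopologicalSpace G] [IsTopologicalGroup G]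
    [CompactSpace G] [T2Space G] [SecondCountableTopology G] [MeasurableSpace G] [BorelSpace G]
    {X : Type*} [TopologicalSpace X] [T2Space X] [MeasurableSpace X] [BorelSpace X]
    [MulAction G X] [ContinuousSMul G X] [MulAction.IsPretransitive G X] (x₀ : X)
    (μ : Measure G) [μ.IsHaarMeasure] [IsProbabilityMeasure μ]

/-- The lift `φ ↦ φ (· • x₀)` as an isometry `L²(X) → L²(G)`. -/
noncomputable def liftLp : Lp ℂ 2 (invMeasure μ x₀) →ₗᵢ[ℂ] Lp ℂ 2 μ :=
  Lp.compMeasurePreservingₗᵢ ℂ (fun g : G => g • x₀) (measurePreserving_orbit μ x₀)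

theorem coeFn_liftLp (φ : Lp ℂ 2 (invMeasure μ x₀)) : liftLp x₀ μ φ =ᵐ[μ] lift x₀ φ :=
  Lp.coeFn_compMeasurePreserving φ (measurePreserving_orbit μ x₀)

instance isProbabilityMeasure_invMeasure : IsProbabilityMeasure (invMeasure μ x₀) :=
  Measure.isProbabilityMeasure_map (measurePreserving_orbit μ x₀).measurable.aemeasurable

theorem bullet_eq_integral (φ ψ : Lp ℂ 2 (invMeasure μ x₀)) (g : G) :
    bullet μ x₀ φ ψ g = ∫ k, φ (k • x₀) * (starRingEnd ℂ) (ψ (g⁻¹ • k • x₀)) ∂μ := by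
  have hm := (measurePreserving_orbit μ x₀).measurable
  refine integral_map hm.aemeasurable ?_
  have h1 := (Lp.stronglyMeasurable φ)
  have h2 := (Lp.stronglyMeasurable ψ).comp_measurable
    (continuous_const_smul g⁻¹ : Continuous fun x : X => g⁻¹ • x).measurable
  exact (h1.mul (RCLike.continuous_conj.comp_stronglyMeasurable h2)).aestronglyMeasurable

theorem bullet_eq_corr (φ ψ : Lp ℂ 2 (invMeasure μ x₀)) (g : G) :
    bullet μ x₀ φ ψ g = corr μ (liftLp x₀ μ ψ) (liftLp x₀ μ φ) g := by
  rw [bullet_eq_integral, corr_eq_integral]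
  refine integral_congr_ae ?_
  filter_upwards [coeFn_liftLp x₀ μ φ, (measurePreserving_mul_left μ
    g⁻¹).quasiMeasurePreserving.ae (coeFn_liftLp x₀ μ ψ)] with k h1 h2
  rw [h1, h2, lift, lift, mul_smul]

variable {x₀ μ} in
theorem bullet_mul_stabilizer {ψ : Lp ℂ 2 (invMeasure μ x₀)} (hψ : IsZonal μ x₀ ψ)
    (φ : Lp ℂ 2 (invMeasure μ x₀)) (g : G) {h : G} (hh : h ∈ MulAction.stabilizer G x₀) :
    bullet μ x₀ φ ψ (g * h) = bullet μ x₀ φ ψ g := by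
  rw [bullet_eq_integral, bullet_eq_integral]
  have h1 := (measurePreserving_orbit μ x₀).quasiMeasurePreserving.ae
    (hψ h⁻¹ (inv_mem hh))
  refine integral_congr_ae ?_
  filter_upwards [(measurePreserving_mul_left μ g⁻¹).quasiMeasurePreserving.ae h1] with k hk
  rw [mul_smul] at hk
  rw [mul_inv_rev, mul_smul, hk]

variable {x₀ μ} in
theorem bullet_eq_of_smul_eq {ψ : Lp ℂ 2 (invMeasure μ x₀)} (hψ : IsZonal μ x₀ ψ)
    (φ : Lp ℂ 2 (invMeasure μ x₀)) {g g' : G} (hg : g' • x₀ = g • x₀) :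
    bullet μ x₀ φ ψ g' = bullet μ x₀ φ ψ g := by
  have hh : g⁻¹ * g' ∈ MulAction.stabilizer G x₀ := by
    rw [MulAction.mem_stabilizer_iff, mul_smul, hg, inv_smul_smul]
  rw [← bullet_mul_stabilizer hψ φ g hh, mul_inv_cancel_left]

variable {x₀ μ} in
theorem waveletTransform_smul {ψ : ℝ → Lp ℂ 2 (invMeasure μ x₀)} {ρ : ℝ}
    (hψ : IsZonal μ x₀ (ψ ρ)) (φ : Lp ℂ 2 (invMeasure μ x₀)) (g : G) :
    waveletTransform μ x₀ ψ φ (ρ, g • x₀) = bullet μ x₀ φ (ψ ρ) g :=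
  bullet_eq_of_smul_eq hψ φ (Classical.choose_spec (MulAction.exists_smul_eq G x₀ (g • x₀)))

/-- Hence `X` inherits second countability from `G`, and continuity on `X` can be tested after
lifting. -/
theorem isOpenQuotientMap_orbit : IsOpenQuotientMap fun g : G => g • x₀ := by
  have hs : Function.Surjective fun g : G => g • x₀ := MulAction.surjective_smul G x₀
  have hc : Continuous fun g : G => g • x₀ := by fun_prop
  have : CompactSpace X := ⟨by rw [← hs.range_eq]; exact isCompact_range hc⟩
  exact ⟨hs, hc, isOpenMap_smul_of_sigmaCompact x₀⟩

theorem rightTranslate_liftLp (φ : Lp ℂ 2 (invMeasure μ x₀)) {h : G}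
    (hh : h ∈ MulAction.stabilizer G x₀) :
    rightTranslate μ h (liftLp x₀ μ φ) = liftLp x₀ μ φ := by
  refine Lp.ext ?_
  filter_upwards [coeFn_rightTranslate μ h (liftLp x₀ μ φ), coeFn_liftLp x₀ μ φ,
    (measurePreserving_mul_right μ h).quasiMeasurePreserving.ae (coeFn_liftLp x₀ μ φ)]
    with k h1 h2 h3
  rw [h1, h2, h3, lift, lift, mul_smul, MulAction.mem_stabilizer_iff.mp hh]

theorem lift_selfConv (ψ : Lp ℂ 2 (invMeasure μ x₀)) :
    lift x₀ (selfConv μ x₀ ψ) = fun g => ∫ y, (starRingEnd ℂ) (liftLp x₀ μ ψ y⁻¹) *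
      liftLp x₀ μ ψ (y⁻¹ * g) ∂μ := by
  funext g
  rw [lift, selfConv, conv]
  refine integral_congr_ae ?_
  have hi := Measure.measurePreserving_inv μ
  filter_upwards [hi.quasiMeasurePreserving.ae (coeFn_liftLp x₀ μ ψ),
    ((measurePreserving_mul_right μ g).comp hi).quasiMeasurePreserving.ae
      (coeFn_liftLp x₀ μ ψ)] with y h1 h2
  simp only [Function.comp_apply] at h2
  rw [h1, h2, involution, lift, lift, mul_smul]

variable {x₀ μ} in
-- A Carathéodory argument: continuity in `x` for fixed `ρ` and measurability in `ρ` for fixed `x`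
-- give joint measurability, whatever representatives `g` with `g • x₀ = x` were chosen.
theorem aestronglyMeasurable_waveletTransform {s : Measure ℝ} [SFinite s]
    {ψ : ℝ → Lp ℂ 2 (invMeasure μ x₀)} (hψ : AEStronglyMeasurable ψ s)
    (hz : ∀ᵐ ρ ∂s, IsZonal μ x₀ (ψ ρ)) (φ : Lp ℂ 2 (invMeasure μ x₀)) :
    AEStronglyMeasurable (waveletTransform μ x₀ ψ φ) (s.prod (invMeasure μ x₀)) := by
  have hq := isOpenQuotientMap_orbit (G := G) x₀
  have : CompactSpace X := ⟨by
    rw [← hq.surjective.range_eq]; exact isCompact_range hq.continuous⟩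
  have : SecondCountableTopology X :=
    hq.isQuotientMap.secondCountableTopology hq.isOpenMap
  -- The argument needs zonality and measurability at every `ρ`, so the family is replaced by zero
  -- on a measurable null set containing all exceptional `ρ`.
  set N : Set ℝ := toMeasurable s {ρ | ¬ (ψ ρ = hψ.mk ψ ρ ∧ IsZonal μ x₀ (ψ ρ))} with hN
  have hNm : MeasurableSet N := measurableSet_toMeasurable _ _
  have hN0 : s N = 0 := by
    rw [hN, measure_toMeasurable]
    exact (hψ.ae_eq_mk.and hz)
  set ψ' : ℝ → Lp ℂ 2 (invMeasure μ x₀) := Nᶜ.indicator (hψ.mk ψ) with hψ'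
  have hψ'm : StronglyMeasurable ψ' := hψ.stronglyMeasurable_mk.indicator hNm.compl
  have hnot : ∀ ρ, ρ ∉ N → ψ' ρ = ψ ρ ∧ IsZonal μ x₀ (ψ ρ) := fun ρ hρ => by
    have h : ψ ρ = hψ.mk ψ ρ ∧ IsZonal μ x₀ (ψ ρ) := by
      by_contra hc
      exact hρ (subset_toMeasurable _ _ hc)
    exact ⟨by rw [hψ', indicator_of_mem (mem_compl hρ), h.1], h.2⟩
  let u : X → ℝ → ℂ := fun x ρ => waveletTransform μ x₀ ψ' φ (ρ, x)
  have hu1 : ∀ ρ, Continuous fun x => u x ρ := fun ρ => by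
    rw [hq.isQuotientMap.continuous_iff]
    have hzon : IsZonal μ x₀ (ψ' ρ) := by
      by_cases hρ : ρ ∈ N
      · have h0 : ψ' ρ = 0 := indicator_of_notMem (by simpa using hρ) _
        intro h _
        have hmp : MeasurePreserving (fun x : X => h • x) (invMeasure μ x₀) (invMeasure μ x₀) := by
          refine ⟨(continuous_const_smul h).measurable, ?_⟩
          rw [invMeasure, Measure.map_map (continuous_const_smul h).measurable
            hq.continuous.measurable]
          have : (fun x : X => h • x) ∘ (fun g : G => g • x₀) =
              (fun g : G => g • x₀) ∘ fun g => h * g := by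
            funext g
            simp [mul_smul]
          rw [this, ← Measure.map_map hq.continuous.measurable (measurable_const_mul h),
            map_mul_left_eq_self]
        rw [h0]
        have hz0 := Lp.coeFn_zero ℂ 2 (invMeasure μ x₀)
        filter_upwards [hz0, hmp.quasiMeasurePreserving.ae hz0] with x h1 h2
        rw [h1, h2]
        rfl
      · rw [(hnot ρ hρ).1]
        exact (hnot ρ hρ).2
    have he : (fun x => u x ρ) ∘ (fun g : G => g • x₀) =
        fun g => corr μ (liftLp x₀ μ (ψ' ρ)) (liftLp x₀ μ φ) g := by
      funext g
      rw [← bullet_eq_corr]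
      exact waveletTransform_smul hzon φ g
    rw [he]
    exact continuous_corr_right μ _ _
  have hu2 : ∀ x, StronglyMeasurable (u x) := fun x => by
    have : u x = fun ρ => inner ℂ (leftTranslate μ (Classical.choose
        (MulAction.exists_smul_eq G x₀ x)) (liftLp x₀ μ (ψ' ρ))) (liftLp x₀ μ φ) := by
      funext ρ
      exact bullet_eq_corr x₀ μ φ (ψ' ρ) _
    rw [this]
    have hc : Continuous fun v : Lp ℂ 2 (invMeasure μ x₀) => (inner ℂ (leftTranslate μ
        (Classical.choose (MulAction.exists_smul_eq G x₀ x)) (liftLp x₀ μ v))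
          (liftLp x₀ μ φ) : ℂ) :=
      ((leftTranslate μ _).continuous.comp (liftLp x₀ μ).continuous).inner continuous_const
    exact hc.comp_stronglyMeasurable hψ'm
  have hu := (stronglyMeasurable_uncurry_of_continuous_of_stronglyMeasurable hu1
    hu2).comp_measurable measurable_swap
  refine ⟨_, hu, ?_⟩
  have hae : ∀ᵐ ρ ∂s, ρ ∉ N := measure_eq_zero_iff_ae_notMem.mp hN0
  filter_upwards [Measure.quasiMeasurePreserving_fst.ae hae] with z hzN
  simp only [waveletTransform, Function.comp_apply, Function.uncurry, Prod.swap, u,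
    (hnot z.1 hzN).1]

variable {x₀ μ} in
theorem eLpNorm_waveletTransform {s : Measure ℝ} [SFinite s]
    {ψ : ℝ → Lp ℂ 2 (invMeasure μ x₀)} (hψ : AEStronglyMeasurable ψ s)
    (hz : ∀ᵐ ρ ∂s, IsZonal μ x₀ (ψ ρ)) (φ : Lp ℂ 2 (invMeasure μ x₀)) :
    eLpNorm (waveletTransform μ x₀ ψ φ) 2 (s.prod (invMeasure μ x₀)) =
      eLpNorm (analysis μ (fun ρ => liftLp x₀ μ (ψ ρ)) (liftLp x₀ μ φ)) 2 (s.prod μ) := by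
  have hmp : MeasurePreserving (Prod.map id fun g : G => g • x₀) (s.prod μ)
      (s.prod (invMeasure μ x₀)) :=
    (MeasurePreserving.id s).prod (measurePreserving_orbit μ x₀)
  rw [← eLpNorm_comp_measurePreserving (aestronglyMeasurable_waveletTransform hψ hz φ) hmp]
  refine eLpNorm_congr_ae ?_
  filter_upwards [Measure.quasiMeasurePreserving_fst.ae hz] with z hzz
  exact (waveletTransform_smul hzz φ z.2).trans (bullet_eq_corr x₀ μ φ _ _)

variable {x₀ μ} in
-- Admissibility equates the integral of `ŵ ŵ*` over `ρ > t` with `P p̂_t P`, and `p̂_t → 1` as `t →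
-- 0`. The functions `tr (π(g) A)` are finite combinations of coefficients.
theorem isReproduced_of_isZonalWaveletFamily
    {ν : Measure (MulAction.stabilizer G x₀)} [IsProbabilityMeasure ν]
    {S : Set (UnitaryDual G)} {p : ℝ → Lp ℂ 1 μ} (hp : IsDiffusiveApproxIdentity μ S p)
    {α : ℝ → ℝ} (hα : Measurable α) (hα_nonneg : ∀ ρ : ℝ, 0 < ρ → 0 ≤ α ρ)
    {ψ : ℝ → Lp ℂ 2 (invMeasure μ x₀)} (hψ : IsZonalWaveletFamily μ x₀ ν S p α ψ)
    {f : Lp ℂ 2 μ} (hf : f ∈ Submodule.span ℂ {f : Lp ℂ 2 μ | ∃ π : IrrUnitaryRep G, π.cls ∈ S ∧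
      ∃ A : Matrix (Fin π.dim) (Fin π.dim) ℂ,
        (f : G → ℂ) =ᵐ[μ] fun g => (π.mat g * A).trace}) :
    IsReproduced μ ν (scaleMeasure α) (fun ρ => liftLp x₀ μ (ψ ρ)) f := by
  have hF : ∀ (π : IrrUnitaryRep G) (ρ : ℝ),
      fourierCoeff μ (lift x₀ (selfConv μ x₀ (ψ ρ))) π =
        fourierCoeff μ (liftLp x₀ μ (ψ ρ)) π *
          (fourierCoeff μ (liftLp x₀ μ (ψ ρ)) π).conjTranspose := fun π ρ => by
    rw [lift_selfConv, fourierCoeff_selfConv]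
  have hcoeff : ∀ π : IrrUnitaryRep G, π.cls ∈ S → ∀ i j, IsReproduced μ ν (scaleMeasure α)
      (fun ρ => liftLp x₀ μ (ψ ρ)) (coeff μ π i j) := fun π hπ => by
    refine isReproduced_coeff π (fun t ht i j => ?_) fun i j => ?_
    · rw [integrableOn_scaleMeasure_iff hα hα_nonneg _ ht.le]
      simpa only [hF] using hψ.integrable t ht π i j
    · have hlim : Tendsto (fun t => subgroupAverage ν π * fourierCoeff μ (p t) π *
          subgroupAverage ν π) (𝓝[>] 0) (𝓝 (subgroupAverage ν π * 1 * subgroupAverage ν π)) :=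
        (tendsto_const_nhds.mul (hp.tendsto_one π)).mul tendsto_const_nhds
      rw [mul_one] at hlim
      refine ((tendsto_pi_nhds.mp (tendsto_pi_nhds.mp hlim i)) j).congr' ?_
      filter_upwards [self_mem_nhdsWithin] with t ht
      rw [setIntegral_scaleMeasure hα hα_nonneg _ (le_of_lt ht)]
      have h1 := hψ.admissible t ht π hπ i j
      simp only [hF] at h1
      rw [← h1, ← fourierCoeff_biAverage μ ν (L1.integrable_coeFn (p t)) π]
      rfl
  induction hf using Submodule.span_induction with
  | mem f h =>
    obtain ⟨π, hπ, A, hA⟩ := h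
    have he : f = ∑ i, ∑ j, A j i • coeff μ π i j := by
      refine Lp.ext (hA.trans ?_)
      have h1 : ∀ᵐ g ∂μ, ∀ i j, (coeff μ π i j : G → ℂ) g = π.mat g i j :=
        ae_all_iff.mpr fun i => ae_all_iff.mpr fun j => coeFn_coeff μ π i j
      have h2 : ∀ᵐ g ∂μ, ∀ i j, (A j i • coeff μ π i j : Lp ℂ 2 μ) g =
          A j i * (coeff μ π i j : G → ℂ) g :=
        ae_all_iff.mpr fun i => ae_all_iff.mpr fun j => Lp.coeFn_smul _ _
      have h3 : ∀ᵐ g ∂μ, ∀ i, (∑ j, A j i • coeff μ π i j : Lp ℂ 2 μ) g =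
          ∑ j, (A j i • coeff μ π i j : Lp ℂ 2 μ) g :=
        ae_all_iff.mpr fun i => Lp.coeFn_fun_finsetSum _ _
      filter_upwards [h1, h2, h3, Lp.coeFn_fun_finsetSum Finset.univ
        fun i => ∑ j, A j i • coeff μ π i j] with g e1 e2 e3 e4
      rw [e4, Matrix.trace]
      refine Finset.sum_congr rfl fun i _ => ?_
      rw [e3, Matrix.diag_apply, Matrix.mul_apply]
      refine Finset.sum_congr rfl fun j _ => ?_
      rw [e2, e1, mul_comm]
    rw [he]
    exact isReproduced_sum fun i _ => isReproduced_sum fun j _ => (hcoeff π hπ i j).smul _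
  | zero => exact isReproduced_zero _ _ _ _
  | add f f' _ _ h h' => exact h.add h'
  | smul c f _ h => exact h.smul c

end HomogeneousSpace

end DiffusiveWavelet

/-! ### The isometry on `L²_0(X)` -/

open DiffusiveWavelet
theorem theorem4p9
    {E : Type*} [NormedAddCommGroup E] [NormedSpace ℝ E] [FiniteDimensional ℝ E]
    {G : Type*} [Group G] [TopologicalSpace G] [ChartedSpace E G] [LieGroup 𝓘(ℝ, E) ∞ G]
    [CompactSpace G] [T2Space G] [MeasurableSpace G] [BorelSpace G]
    {X : Type*} [TopologicalSpace X] [T2Space X] [MeasurableSpace X] [BorelSpace X]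
    [MulAction G X] [ContinuousSMul G X] [MulAction.IsPretransitive G X] (x₀ : X)
    (μ : Measure G) [μ.IsHaarMeasure] [IsProbabilityMeasure μ]
    (ν : Measure (MulAction.stabilizer G x₀)) [ν.IsHaarMeasure] [IsProbabilityMeasure ν]
    (S : Set (UnitaryDual G)) (p : ℝ → Lp ℂ 1 μ) (hp : IsDiffusiveApproxIdentity μ S p)
    (α : ℝ → ℝ) (hα : Measurable α) (hα_nonneg : ∀ ρ : ℝ, 0 < ρ → 0 ≤ α ρ)
    (ψ : ℝ → Lp ℂ 2 (invMeasure μ x₀)) (hψ_meas : AEStronglyMeasurable ψ (scaleMeasure α))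
    (hψ : IsZonalWaveletFamily μ x₀ ν S p α ψ) :
    (∀ φ : L2ZeroSpace μ x₀ S, ∀ ρ : ℝ, 0 < ρ → ∀ g : G,
      waveletTransform μ x₀ ψ (φ : Lp ℂ 2 (invMeasure μ x₀)) (ρ, g • x₀) =
        bullet μ x₀ (φ : Lp ℂ 2 (invMeasure μ x₀)) (ψ ρ) g) ∧
    ∃ W : L2ZeroSpace μ x₀ S →ₗᵢ[ℂ] Lp ℂ 2 ((scaleMeasure α).prod (invMeasure μ x₀)),
      ∀ φ : L2ZeroSpace μ x₀ S,
        (W φ : ℝ × X → ℂ) =ᵐ[(scaleMeasure α).prod (invMeasure μ x₀)]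
          waveletTransform μ x₀ ψ (φ : Lp ℂ 2 (invMeasure μ x₀)) := by
  have : IsTopologicalGroup G := topologicalGroup_of_lieGroup 𝓘(ℝ, E) ∞
  have : SecondCountableTopology G := ChartedSpace.secondCountable_of_sigmaCompact E G
  have : SigmaFinite (scaleMeasure α) := by
    unfold scaleMeasure
    infer_instance
  refine ⟨fun φ ρ hρ g => waveletTransform_smul (hψ.zonal ρ hρ) _ g, ?_⟩
  have hz : ∀ᵐ ρ ∂(scaleMeasure α), IsZonal μ x₀ (ψ ρ) := by
    filter_upwards [ae_scaleMeasure_pos] with ρ hρ using hψ.zonal ρ hρ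
  have hw : AEStronglyMeasurable (fun ρ => liftLp x₀ μ (ψ ρ)) (scaleMeasure α) :=
    (liftLp x₀ μ).continuous.comp_aestronglyMeasurable hψ_meas
  have hnorm : ∀ φ : L2ZeroSpace μ x₀ S,
      eLpNorm (waveletTransform μ x₀ ψ (φ : Lp ℂ 2 (invMeasure μ x₀))) 2
        ((scaleMeasure α).prod (invMeasure μ x₀)) = ENNReal.ofReal ‖φ‖ := fun φ => by
    -- The lift lies in the closed span and is right invariant under the stabiliser: the two inputs
    -- of the norm identity on `G`.
    have hφ : liftLp x₀ μ φ ∈ L2ZeroGroup μ S := φ.2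
    rw [eLpNorm_waveletTransform hψ_meas hz, eLpNorm_analysis_eq
      (fun f hf => isReproduced_of_isZonalWaveletFamily hp hα hα_nonneg hψ hf) hw
      scaleMeasure_restrict_Ioi_zero hφ fun h => rightTranslate_liftLp x₀ μ _ h.2,
      LinearIsometry.norm_map]
    rfl
  have hmem : ∀ φ : L2ZeroSpace μ x₀ S,
      MemLp (waveletTransform μ x₀ ψ (φ : Lp ℂ 2 (invMeasure μ x₀))) 2
        ((scaleMeasure α).prod (invMeasure μ x₀)) := fun φ =>
    ⟨aestronglyMeasurable_waveletTransform hψ_meas hz _, by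
      rw [hnorm]; exact ENNReal.ofReal_lt_top⟩
  refine ⟨{ toFun := fun φ => (hmem φ).toLp _
            map_add' := fun φ φ' => ?_
            map_smul' := fun c φ => ?_
            norm_map' := fun φ => ?_ }, fun φ => (hmem φ).coeFn_toLp⟩
  · rw [← MemLp.toLp_add]
    refine MemLp.toLp_congr _ _ (ae_of_all _ fun z => ?_)
    simp only [waveletTransform, bullet_eq_corr, Submodule.coe_add, map_add, corr_add,
      Pi.add_apply]
  · rw [RingHom.id_apply, ← MemLp.toLp_const_smul]
    refine MemLp.toLp_congr _ _ (ae_of_all _ fun z => ?_)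
    simp only [waveletTransform, bullet_eq_corr, Submodule.coe_smul, map_smul, corr_smul,
      Pi.smul_apply, smul_eq_mul]
  · simp only [LinearMap.coe_mk, AddHom.coe_mk]
    rw [Lp.norm_toLp, hnorm, ENNReal.toReal_ofReal (norm_nonneg _)]
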